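/- Let $n\in\mathbb N$ and let $\mathcal S(\mathbb Z^n)$ be the space of rapidly decreasing functions $g:\mathbb Z^n\to\mathbb C$, with the topology of the seminorms $p_j(g)=\sup_{k}(1+|k|)^j|g(k)|$, $j\in\mathbb N_0$; let $\mathcal S'(\mathbb Z^n)$ be the space of continuous linear functionals on it. Let $\mathbb T^n=(\mathbb R/\mathbb Z)^n$ with normalized Haar measure, and give $\mathbb Z^n\times\mathbb T^n$ the product of counting measure and Haar measure. Fix a window $0\neq g\in\mathcal S(\mathbb Z^n)$. The short-time Fourier transform of $f\in\mathcal S'(\mathbb Z^n)$ is $$V_gf(m,w)=\langle f,M_wT_mg\rangle=\sum_{k\in\mathbb Z^n}f(k)\,\overline{g(k-m)}\,e^{-2\pi i w\cdot k},\qquad (m,w)\in\mathbb Z^n\times\mathbb T^n .$$ For $0<p\le\infty$ let $M^p(\mathbb Z^n)$ be the set of $f\in\mathcal S'(\mathbb Z^n)$ with $\|f\|_{M^p}:=\|V_gf\|_{L^p(\mathbb Z^n\times\mathbb T^n)}<\infty$ (a quasi-norm if $p<1$). A Young function is a convex function $\Phi:[0,\infty]\to[0,\infty]$ with $\Phi(0)=0$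 and $\lim_{t\to\infty}\Phi(t)=\Phi(\infty)=\infty$. For such $\Phi$ let $M^\Phi(\mathbb Z^n)$ be the set of $f\in\mathcal S'(\mathbb Z^n)$ with $\|f\|_{M^\Phi}:=\|V_gf\|_{L^\Phi}<\infty$, where $$\|F\|_{L^\Phi}=\inf\Big\{b>0:\ \sum_{m\in\mathbb Z^n}\int_{\mathbb T^n}\Phi\big(|F(m,w)|/b\big)\,dw\le 1\Big\}.$$ Suppose that $\Phi$ is a Young function with $$\Phi(x)=-x^2\log x\qquad\text{for } 0\le x\le e^{-3/2}$$ (the value at $x=0$ being $0$). Then for every $0<p<2$ $$M^p(\mathbb Z^n)\subseteq M^\Phi(\mathbb Z^n)\subseteq M^2(\mathbb Z^n),$$ and both inclusions are continuous and dense: there is a constant $C$ (depending only on $n,g,p,\Phi$) with $\|f\|_{M^\Phi}\le C\|f\|_{M^p}$ for all $f\in M^p(\mathbb Z^n)$ and a constant $C'$ (depending only on $n,g,\Phi$) with $\|f\|_{M^2}\le C'\|f\|_{M^\Phi}$ for all $f\in M^\Phi(\mathbb Z^n)$; $M^p(\mathbb Z^n)$ is dense in $M^\Phi(\mathbb Z^n)$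 for $\|\cdot\|_{M^\Phi}$, and $M^\Phi(\mathbb Z^n)$ is dense in $M^2(\mathbb Z^n)$ for $\|\cdot\|_{M^2}$. -/

import Mathlib

open MeasureTheory Filter Topology
open scoped ENNReal NNReal ComplexConjugate

namespace OrliczModulation

/-! ### The Schwartz space on `ℤⁿ` and tempered distributions -/

/-- Rapidly decreasing functions `ℤⁿ → ℂ`, as a subspace of all functions. -/
def rapidlyDecreasing (n : ℕ) : Submodule ℂ ((Fin n → ℤ) → ℂ) where
  carrier := {g | ∀ j : ℕ, ∃ C : ℝ, ∀ k, (1 + ‖k‖) ^ j * ‖g k‖ ≤ C}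
  zero_mem' := fun _ => ⟨0, fun _ => by simp⟩
  add_mem' := by
    intro a b ha hb j
    obtain ⟨A, hA⟩ := ha j
    obtain ⟨B, hB⟩ := hb j
    refine ⟨A + B, fun k => ?_⟩
    calc (1 + ‖k‖) ^ j * ‖a k + b k‖ ≤ (1 + ‖k‖) ^ j * (‖a k‖ + ‖b k‖) := by
          gcongr; exact norm_add_le _ _
      _ = (1 + ‖k‖) ^ j * ‖a k‖ + (1 + ‖k‖) ^ j * ‖b k‖ := by ring
      _ ≤ A + B := add_le_add (hA k) (hB k)
  smul_mem' := by
    intro c a ha j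
    obtain ⟨A, hA⟩ := ha j
    refine ⟨‖c‖ * A, fun k => ?_⟩
    calc (1 + ‖k‖) ^ j * ‖c • a k‖ = ‖c‖ * ((1 + ‖k‖) ^ j * ‖a k‖) := by
          rw [norm_smul]; ring
      _ ≤ ‖c‖ * A := by gcongr; exact hA k

/-- The Schwartz space `𝒮(ℤⁿ)`. It is a type of its own, so that it carries the topology of the
seminorms `p_j` below and not the topology of pointwise convergence. -/
def SchwartzZ (n : ℕ) : Type := rapidlyDecreasing n

noncomputable instance (n : ℕ) : AddCommGroup (SchwartzZ n) :=
  inferInstanceAs (AddCommGroup (rapidlyDecreasing n))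

noncomputable instance (n : ℕ) : Module ℂ (SchwartzZ n) :=
  inferInstanceAs (Module ℂ (rapidlyDecreasing n))

instance (n : ℕ) : CoeFun (SchwartzZ n) (fun _ => (Fin n → ℤ) → ℂ) := ⟨fun g => g.1⟩

theorem SchwartzZ.bddAbove {n : ℕ} (g : SchwartzZ n) (j : ℕ) :
    BddAbove (Set.range fun k : Fin n → ℤ => (1 + ‖k‖) ^ j * ‖g k‖) := by
  obtain ⟨C, hC⟩ := g.2 j
  exact ⟨C, by rintro _ ⟨k, rfl⟩; exact hC k⟩

/-- The seminorm `p_j(g) = sup_k (1 + |k|)^j |g(k)|`. -/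
noncomputable def schwartzSeminormZ (n : ℕ) (j : ℕ) : Seminorm ℂ (SchwartzZ n) :=
  Seminorm.of (fun g => ⨆ k : Fin n → ℤ, (1 + ‖k‖) ^ j * ‖g k‖)
    (by
      intro a b
      refine ciSup_le fun k => ?_
      calc (1 + ‖k‖) ^ j * ‖a k + b k‖ ≤ (1 + ‖k‖) ^ j * (‖a k‖ + ‖b k‖) := by
            gcongr; exact norm_add_le _ _
        _ = (1 + ‖k‖) ^ j * ‖a k‖ + (1 + ‖k‖) ^ j * ‖b k‖ := by ring
        _ ≤ _ := add_le_add (le_ciSup (a.bddAbove j) k) (le_ciSup (b.bddAbove j) k))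
    (by
      intro c a
      rw [Real.mul_iSup_of_nonneg (norm_nonneg c)]
      refine iSup_congr fun k => ?_
      change (1 + ‖k‖) ^ j * ‖c • a k‖ = _
      rw [norm_smul]; ring)

/-- The topology of `𝒮(ℤⁿ)` generated by the seminorms `p_j`, `j ∈ ℕ`. -/
noncomputable instance (n : ℕ) : TopologicalSpace (SchwartzZ n) :=
  (SeminormFamily.moduleFilterBasis (𝕜 := ℂ) (schwartzSeminormZ n)).topology'

theorem withSeminorms_schwartzZ (n : ℕ) : WithSeminorms (𝕜 := ℂ) (schwartzSeminormZ n) := by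
  have A : WithSeminorms (𝕜 := ℂ) (schwartzSeminormZ n) := ⟨rfl⟩
  exact A

/-- Tempered distributions on `ℤⁿ`: the continuous linear functionals on `𝒮(ℤⁿ)`. -/
abbrev TemperedZ (n : ℕ) : Type := SchwartzZ n →L[ℂ] ℂ

/-! ### Time-frequency shifts and the short-time Fourier transform -/

/-- Translation, `T_m g (k) = g (k - m)`. -/
def translate {n : ℕ} (m : Fin n → ℤ) (g : SchwartzZ n) : SchwartzZ n :=
  ⟨fun k => g (k - m), by
    intro j
    obtain ⟨C, hC⟩ := g.2 j
    refine ⟨(1 + ‖m‖) ^ j * C, fun k => ?_⟩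
    have h1 : 1 + ‖k‖ ≤ (1 + ‖m‖) * (1 + ‖k - m‖) := by
      have h2 : ‖k‖ ≤ ‖k - m‖ + ‖m‖ := by simpa using norm_add_le (k - m) m
      nlinarith [mul_nonneg (norm_nonneg m) (norm_nonneg (k - m))]
    calc (1 + ‖k‖) ^ j * ‖g (k - m)‖ ≤ ((1 + ‖m‖) * (1 + ‖k - m‖)) ^ j * ‖g (k - m)‖ := by
          gcongr
      _ = (1 + ‖m‖) ^ j * ((1 + ‖k - m‖) ^ j * ‖g (k - m)‖) := by rw [mul_pow]; ring
      _ ≤ (1 + ‖m‖) ^ j * C := by gcongr; exact hC _⟩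

theorem norm_mFourier_apply {n : ℕ} (k : Fin n → ℤ) (w : UnitAddTorus (Fin n)) :
    ‖UnitAddTorus.mFourier k w‖ = 1 := by
  simp [UnitAddTorus.mFourier, fourier_apply, Circle.norm_coe, -zsmul_eq_mul]

/-- Modulation, `M_w g (k) = e^{2πi w·k} g(k)`, for `w` in the torus `𝕋ⁿ = (ℝ/ℤ)ⁿ`. -/
noncomputable def modulate {n : ℕ} (w : UnitAddTorus (Fin n)) (g : SchwartzZ n) : SchwartzZ n :=
  ⟨fun k => UnitAddTorus.mFourier k w * g k, by
    intro j
    obtain ⟨C, hC⟩ := g.2 j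
    refine ⟨C, fun k => ?_⟩
    rw [norm_mul, norm_mFourier_apply, one_mul]
    exact hC k⟩

/-- Pointwise complex conjugation. -/
noncomputable def conjugate {n : ℕ} (g : SchwartzZ n) : SchwartzZ n :=
  ⟨fun k => conj (g k), by
    intro j
    obtain ⟨C, hC⟩ := g.2 j
    refine ⟨C, fun k => ?_⟩
    rw [RCLike.norm_conj]
    exact hC k⟩

/-- The short-time Fourier transform `V_g f (m, w) = ⟨f, M_w T_m g⟩` of a tempered distribution.
The pairing is conjugate linear in the second slot and extends `∑ₖ f(k) conj (h k)`, that is,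
`⟨f, h⟩` is the functional `f` evaluated at the conjugate of `h`. -/
noncomputable def stft {n : ℕ} (g : SchwartzZ n) (f : TemperedZ n)
    (z : (Fin n → ℤ) × UnitAddTorus (Fin n)) : ℂ :=
  f (conjugate (modulate z.2 (translate z.1 g)))

/-- The measure on `ℤⁿ × 𝕋ⁿ`: counting measure times normalized Haar measure. -/
noncomputable def phaseMeasure (n : ℕ) : Measure ((Fin n → ℤ) × UnitAddTorus (Fin n)) :=
  (Measure.count : Measure (Fin n → ℤ)).prod (volume : Measure (UnitAddTorus (Fin n)))

/-! ### Young functions and Orlicz spaces -/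

/-- Young functions `Φ : [0, ∞] → [0, ∞]`. -/
structure IsYoung (Φ : ℝ≥0∞ → ℝ≥0∞) : Prop where
  convex : ConvexOn ℝ≥0 Set.univ Φ
  map_zero : Φ 0 = 0
  tendsto_top : Tendsto (fun t : ℝ≥0 => Φ t) atTop (𝓝 ∞)
  map_top : Φ ∞ = ∞

/-- The Luxemburg norm `inf {b > 0 : ∫ Φ(|F| / b) dμ ≤ 1}`, equal to `∞` if there is no such
`b`. -/
noncomputable def orliczNorm {X : Type*} [MeasurableSpace X] (Φ : ℝ≥0∞ → ℝ≥0∞) (F : X → ℂ)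
    (μ : Measure X) : ℝ≥0∞ :=
  ⨅ (b : ℝ≥0) (_ : 0 < b) (_ : ∫⁻ x, Φ (‖F x‖ₑ / b) ∂μ ≤ 1), (b : ℝ≥0∞)

/-- Membership in the Orlicz space `L^Φ(μ)`. -/
def MemOrlicz {X : Type*} [MeasurableSpace X] (Φ : ℝ≥0∞ → ℝ≥0∞) (F : X → ℂ)
    (μ : Measure X) : Prop :=
  AEStronglyMeasurable F μ ∧ orliczNorm Φ F μ < ∞

/-! ### Modulation spaces -/

/-- `‖f‖_{M^p} = ‖V_g f‖_{L^p(ℤⁿ × 𝕋ⁿ)}`. -/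
noncomputable def modNorm {n : ℕ} (g : SchwartzZ n) (p : ℝ≥0∞) (f : TemperedZ n) : ℝ≥0∞ :=
  eLpNorm (stft g f) p (phaseMeasure n)

/-- The modulation space `M^p(ℤⁿ)` with window `g`. -/
def modSpace {n : ℕ} (g : SchwartzZ n) (p : ℝ≥0∞) : Set (TemperedZ n) :=
  {f | MemLp (stft g f) p (phaseMeasure n)}

/-- `‖f‖_{M^Φ} = ‖V_g f‖_{L^Φ(ℤⁿ × 𝕋ⁿ)}`. -/
noncomputable def orliczModNorm {n : ℕ} (g : SchwartzZ n) (Φ : ℝ≥0∞ → ℝ≥0∞)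
    (f : TemperedZ n) : ℝ≥0∞ :=
  orliczNorm Φ (stft g f) (phaseMeasure n)

/-- The Orlicz modulation space `M^Φ(ℤⁿ)` with window `g`. -/
def orliczModSpace {n : ℕ} (g : SchwartzZ n) (Φ : ℝ≥0∞ → ℝ≥0∞) : Set (TemperedZ n) :=
  {f | MemOrlicz Φ (stft g f) (phaseMeasure n)}

end OrliczModulation

namespace OrliczModulation

/-! ### Summability over `ℤⁿ` -/

/-! On `ℤⁿ` everything is governed by the coefficients `f (delta k)`: each slice `w ↦ V_g f (m, w)`
is an absolutely convergent Fourier series with coefficients `f (delta k) * conj (g (k - m))`. Hence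
`|f (delta k)| |g k₀|` is at most the integral of `|V_g f|` over the slice at `k - k₀`
(`enorm_coeff_mul_le`), and conversely `|V_g f|` is at most the convolution-type sum of the
coefficients against `|g|` (`enorm_stft_le`). Fixing `k₀` with `g k₀ ≠ 0`, the supremum of `|V_g f|`
is bounded by a constant times the supremum of its slice integrals, so it is controlled by
`‖f‖_{M^p}` or `‖f‖_{M^Φ}`. After rescaling, only the behaviour of `Φ` near `0` matters, and there
`x² ≤ -x² log x ≤ x^p / (2 - p)`; integrating these two inequalities gives the two inclusions.

For `p < 1` the slice integral is bounded by `S^(1-p)` times the integral of `|V_g f|^p`, `S` being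
the supremum; cancelling `S^(1-p)` requires `S` to be finite, and this comes from the polynomial
growth of tempered distributions (`enorm_stft_rpow_le`).

Both densities follow by truncating `f` to a finite set, since finite combinations of point masses
lie in every `M^p`, `0 < p < ∞`. `exists_lintegral_sub_truncate_le_one` treats `Φ` and `x²`
together. Coefficients in `ℓ²` are small off a finite set, so only arguments near `0` occur, where
`Ψ (t x) ≤ t² Ψ x`; two uses of a weak Jensen inequality, over slices and over the weights `|g (k -
m)|`, bound the remainder by the tail of a convergent series. -/

theorem tsum_int_inv_sq_ne_top : ∑' k : ℤ, ((1 + ‖k‖ₑ) ^ 2)⁻¹ ≠ ∞ := by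
  have h : Summable fun k : ℤ => ((1 + ‖k‖) ^ 2)⁻¹ := by
    have h1 : Summable fun k : ℤ => 1 / (k : ℝ) ^ 2 :=
      Real.summable_one_div_int_pow.mpr one_lt_two
    refine Summable.of_norm_bounded_eventually h1 ?_
    filter_upwards [(Set.finite_singleton (0 : ℤ)).compl_mem_cofinite] with k hk
    have hk0 : (k : ℝ) ≠ 0 := by simpa using hk
    have hk2 : 0 < (k : ℝ) ^ 2 := by positivity
    rw [Real.norm_of_nonneg (by positivity), one_div]
    refine inv_anti₀ hk2 ?_
    rw [← sq_abs, Int.norm_eq_abs]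
    gcongr
    linarith
  have h2 := h.tsum_ofReal_ne_top
  convert h2 using 3 with k
  rw [ENNReal.ofReal_inv_of_pos (by positivity), ENNReal.ofReal_pow (by positivity),
    ENNReal.ofReal_add zero_le_one (norm_nonneg _), ofReal_norm, ENNReal.ofReal_one]

theorem tsum_prod_fin (φ : ℤ → ℝ≥0∞) (n : ℕ) :
    ∑' k : Fin n → ℤ, ∏ i, φ (k i) = (∑' k, φ k) ^ n := by
  induction n with
  | zero => simp
  | succ n ih =>
    rw [← (Fin.consEquiv fun _ : Fin (n + 1) => ℤ).tsum_eq, pow_succ', ← ih,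
      ← ENNReal.tsum_mul_right]
    simp_rw [← ENNReal.tsum_mul_left]
    rw [← ENNReal.tsum_prod]
    simp [Fin.consEquiv, Fin.prod_univ_succ]

theorem tsum_inv_pow_ne_top (n : ℕ) :
    ∑' k : Fin n → ℤ, ((1 + ‖k‖ₑ) ^ (2 * n))⁻¹ ≠ ∞ := by
  refine ne_top_of_le_ne_top (b := (∑' k : ℤ, ((1 + ‖k‖ₑ) ^ 2)⁻¹) ^ n)
    (ENNReal.pow_ne_top tsum_int_inv_sq_ne_top) ?_
  rw [← tsum_prod_fin]
  refine ENNReal.tsum_le_tsum fun k => ?_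
  rw [← ENNReal.prod_inv_distrib (by simp [Set.Pairwise])]
  refine ENNReal.inv_le_inv.mpr ?_
  -- The norm on `ℤⁿ` is the sup norm, so each factor is at most `(1 + ‖k‖)²`; hence the exponent `2
  -- * n`.
  calc ∏ i : Fin n, (1 + ‖k i‖ₑ) ^ 2 ≤ ∏ _i : Fin n, (1 + ‖k‖ₑ) ^ 2 := by
        refine Finset.prod_le_prod' fun i _ => ?_
        gcongr
        exact enorm_le_iff_norm_le.mpr (norm_le_pi_norm k i)
    _ = (1 + ‖k‖ₑ) ^ (2 * n) := by simp [pow_mul]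

theorem SchwartzZ.exists_enorm_le {n : ℕ} (h : SchwartzZ n) (j : ℕ) :
    ∃ C : ℝ≥0∞, C ≠ ∞ ∧ ∀ k, (1 + ‖k‖ₑ) ^ j * ‖h k‖ₑ ≤ C := by
  obtain ⟨C, hC⟩ := h.2 j
  refine ⟨ENNReal.ofReal C, ENNReal.ofReal_ne_top, fun k => ?_⟩
  have := ENNReal.ofReal_le_ofReal (hC k)
  rwa [ENNReal.ofReal_mul (by positivity), ENNReal.ofReal_pow (by positivity),
    ENNReal.ofReal_add zero_le_one (norm_nonneg _), ofReal_norm, ofReal_norm,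
    ENNReal.ofReal_one] at this

theorem SchwartzZ.tsum_ne_top {n : ℕ} (h : SchwartzZ n) (N : ℕ) {q : ℝ} (hq : 0 < q) :
    ∑' k, (1 + ‖k‖ₑ) ^ N * ‖h k‖ₑ ^ q ≠ ∞ := by
  -- Decay of order `M` with `M q ≥ N + 2n` absorbs the weight and leaves the summable factor of
  -- order `2n`, even for small `q`.
  obtain ⟨M, hM⟩ := exists_nat_ge ((N + 2 * n : ℕ) / q)
  have hM' : ((N + 2 * n : ℕ) : ℝ) ≤ M * q := by rwa [div_le_iff₀ hq] at hM
  obtain ⟨C, hC, hb⟩ := h.exists_enorm_le M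
  refine ne_top_of_le_ne_top (b := C ^ q * ∑' k : Fin n → ℤ, ((1 + ‖k‖ₑ) ^ (2 * n))⁻¹)
    (ENNReal.mul_ne_top (by finiteness) (tsum_inv_pow_ne_top n)) ?_
  rw [← ENNReal.tsum_mul_left]
  refine ENNReal.tsum_le_tsum fun k => ?_
  rw [← div_eq_mul_inv, ENNReal.le_div_iff_mul_le (Or.inl (by simp)) (Or.inl (by finiteness))]
  calc (1 + ‖k‖ₑ) ^ N * ‖h k‖ₑ ^ q * (1 + ‖k‖ₑ) ^ (2 * n)
      = (1 + ‖k‖ₑ) ^ ((N + 2 * n : ℕ) : ℝ) * ‖h k‖ₑ ^ q := by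
        rw [ENNReal.rpow_natCast, pow_add]; ring
    _ ≤ (1 + ‖k‖ₑ) ^ (M * q) * ‖h k‖ₑ ^ q := by
        gcongr; simp
    _ = ((1 + ‖k‖ₑ) ^ M * ‖h k‖ₑ) ^ q := by
        rw [ENNReal.mul_rpow_of_nonneg _ _ hq.le, ENNReal.rpow_mul, ENNReal.rpow_natCast]
    _ ≤ C ^ q := by gcongr; exact hb k

theorem SchwartzZ.tsum_enorm_ne_top {n : ℕ} (h : SchwartzZ n) : ∑' k, ‖h k‖ₑ ≠ ∞ := by
  simpa using h.tsum_ne_top 0 one_pos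

theorem SchwartzZ.summable {n : ℕ} (h : SchwartzZ n) (N : ℕ) :
    Summable fun k => (1 + ‖k‖) ^ N * ‖h k‖ := by
  have h1 := h.tsum_ne_top N one_pos
  have h2 := ENNReal.summable_toReal h1
  refine h2.congr fun k => ?_
  rw [ENNReal.rpow_one, ENNReal.toReal_mul, ENNReal.toReal_pow, toReal_enorm,
    ENNReal.toReal_add (by simp) (by simp), toReal_enorm, ENNReal.toReal_one]

/-! ### Point masses and the coefficients of a tempered distribution -/

theorem schwartzSeminormZ_apply {n : ℕ} (j : ℕ) (h : SchwartzZ n) :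
    schwartzSeminormZ n j h = ⨆ k : Fin n → ℤ, (1 + ‖k‖) ^ j * ‖h k‖ := rfl

/-- The point evaluation `h ↦ h k`, as a linear map. -/
def evalLin {n : ℕ} (k : Fin n → ℤ) : SchwartzZ n →ₗ[ℂ] ℂ where
  toFun h := h k
  map_add' _ _ := rfl
  map_smul' _ _ := rfl

theorem evalLin_apply {n : ℕ} (k : Fin n → ℤ) (h : SchwartzZ n) : evalLin k h = h k := rfl

/-- The point evaluation `h ↦ h k`, as a tempered distribution. -/
noncomputable def pointMass {n : ℕ} (k : Fin n → ℤ) : TemperedZ n where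
  toLinearMap := evalLin k
  cont := by
    refine (withSeminorms_schwartzZ n).continuous_normedSpace_rng ℂ (evalLin k) ⟨{0}, 1, ?_⟩
    intro h
    simp only [Finset.sup_singleton, one_smul]
    have := le_ciSup (h.bddAbove 0) k
    simpa [schwartzSeminormZ_apply, evalLin_apply] using this

theorem pointMass_apply {n : ℕ} (k : Fin n → ℤ) (h : SchwartzZ n) : pointMass k h = h k := rfl

/-- The function equal to `1` at `k` and `0` elsewhere. -/
def delta {n : ℕ} (k : Fin n → ℤ) : SchwartzZ n :=
  ⟨fun i => if i = k then 1 else 0, fun j => ⟨(1 + ‖k‖) ^ j, fun i => by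
    dsimp only
    split_ifs with h
    · simp [h]
    · simp; positivity⟩⟩

theorem delta_apply {n : ℕ} (k i : Fin n → ℤ) :
    (delta k : SchwartzZ n) i = if i = k then 1 else 0 := rfl

theorem SchwartzZ.sum_delta_sub_apply {n : ℕ} (h : SchwartzZ n) (F : Finset (Fin n → ℤ))
    (i : Fin n → ℤ) :
    (∑ k ∈ F, h k • delta k - h : SchwartzZ n) i = if i ∈ F then 0 else -h i := by
  rw [← evalLin_apply, map_sub, map_sum]
  simp only [map_smul, evalLin_apply, delta_apply, smul_eq_mul, mul_ite, mul_one, mul_zero,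
    Finset.sum_ite_eq]
  split_ifs <;> simp

/-- The weighted values are summable, so all but finitely many are below `ε / 2`. A partial sum
containing the exceptions differs from `h` only at the remaining points. Consequently a tempered
distribution is determined by its coefficients. -/
theorem SchwartzZ.hasSum_delta {n : ℕ} (h : SchwartzZ n) :
    HasSum (fun k => h k • delta k) h := by
  refine ((withSeminorms_schwartzZ n).tendsto_nhds _ _).mpr fun j ε hε => ?_
  have hfin := (h.summable j).tendsto_cofinite_zero.eventually_lt_const (half_pos hε)
  have hfin' : {k : Fin n → ℤ | ¬ (1 + ‖k‖) ^ j * ‖h k‖ < ε / 2}.Finite := hfin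
  filter_upwards [eventually_ge_atTop hfin'.toFinset] with F hF
  refine lt_of_le_of_lt ?_ (half_lt_self hε)
  rw [schwartzSeminormZ_apply]
  refine ciSup_le fun i => ?_
  rw [SchwartzZ.sum_delta_sub_apply]
  split_ifs with hi
  · simpa using (half_pos hε).le
  · by_contra hlt
    refine hi (hF ?_)
    rw [Set.Finite.mem_toFinset]
    rw [norm_neg] at hlt
    exact fun h' => hlt h'.le

theorem hasSum_coeff {n : ℕ} (f : TemperedZ n) (h : SchwartzZ n) :
    HasSum (fun k => h k * f (delta k)) (f h) := by
  simpa using h.hasSum_delta.mapL f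

/-! ### Growth of tempered distributions -/

theorem exists_seminorm_bound {n : ℕ} (f : TemperedZ n) :
    ∃ (N : ℕ) (C : ℝ), 0 ≤ C ∧ ∀ h, ‖f h‖ ≤ C * schwartzSeminormZ n N h := by
  obtain ⟨s, C, -, hC⟩ := Seminorm.bound_of_continuous (withSeminorms_schwartzZ n)
    ((normSeminorm ℂ ℂ).comp f.toLinearMap) (continuous_norm.comp f.continuous)
  -- The seminorms increase with `j`, so a finite supremum is dominated by the one of largest index.
  refine ⟨s.sup id, C, C.2, fun h => (hC h).trans ?_⟩
  change (C : ℝ) * (s.sup (schwartzSeminormZ n)) h ≤ _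
  gcongr
  refine Seminorm.finset_sup_apply_le (apply_nonneg _ _) fun j hj => ?_
  rw [schwartzSeminormZ_apply, schwartzSeminormZ_apply]
  refine ciSup_mono (h.bddAbove _) fun k => ?_
  gcongr
  · linarith [norm_nonneg k]
  · exact Finset.le_sup (f := id) hj

theorem stft_arg_apply {n : ℕ} (g : SchwartzZ n) (m : Fin n → ℤ) (w : UnitAddTorus (Fin n))
    (k : Fin n → ℤ) :
    (conjugate (modulate w (translate m g))) k
      = UnitAddTorus.mFourier (-k) w * conj (g (k - m)) := by
  change conj (UnitAddTorus.mFourier k w * g (k - m)) = _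
  rw [map_mul, UnitAddTorus.mFourier_neg]

theorem norm_stft_arg_apply {n : ℕ} (g : SchwartzZ n) (m : Fin n → ℤ)
    (w : UnitAddTorus (Fin n)) (k : Fin n → ℤ) :
    ‖(conjugate (modulate w (translate m g))) k‖ = ‖g (k - m)‖ := by
  rw [stft_arg_apply, norm_mul, norm_mFourier_apply, one_mul, RCLike.norm_conj]

theorem one_add_norm_le {n : ℕ} (k m : Fin n → ℤ) : 1 + ‖k‖ ≤ (1 + ‖m‖) * (1 + ‖k - m‖) := by
  have h2 : ‖k‖ ≤ ‖k - m‖ + ‖m‖ := by simpa using norm_add_le (k - m) m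
  nlinarith [mul_nonneg (norm_nonneg m) (norm_nonneg (k - m))]

theorem one_add_enorm_le {n : ℕ} (k m : Fin n → ℤ) :
    1 + ‖k‖ₑ ≤ (1 + ‖m‖ₑ) * (1 + ‖k - m‖ₑ) := by
  have := ENNReal.ofReal_le_ofReal (one_add_norm_le k m)
  rwa [ENNReal.ofReal_mul (by positivity), ENNReal.ofReal_add zero_le_one (norm_nonneg _),
    ENNReal.ofReal_add zero_le_one (norm_nonneg _), ENNReal.ofReal_add zero_le_one (norm_nonneg _),
    ofReal_norm, ofReal_norm, ofReal_norm, ENNReal.ofReal_one] at this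

theorem exists_enorm_stft_le {n : ℕ} (g : SchwartzZ n) (f : TemperedZ n) :
    ∃ (N : ℕ) (C : ℝ≥0∞), C ≠ ∞ ∧ ∀ m w, ‖stft g f (m, w)‖ₑ ≤ C * (1 + ‖m‖ₑ) ^ N := by
  obtain ⟨N, C, hC0, hC⟩ := exists_seminorm_bound f
  obtain ⟨D, hD⟩ := g.2 N
  refine ⟨N, ENNReal.ofReal (C * D), ENNReal.ofReal_ne_top, fun m w => ?_⟩
  have hp : schwartzSeminormZ n N (conjugate (modulate w (translate m g)))
      ≤ (1 + ‖m‖) ^ N * D := by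
    rw [schwartzSeminormZ_apply]
    refine ciSup_le fun k => ?_
    rw [norm_stft_arg_apply]
    calc (1 + ‖k‖) ^ N * ‖g (k - m)‖
        ≤ ((1 + ‖m‖) * (1 + ‖k - m‖)) ^ N * ‖g (k - m)‖ := by
          gcongr; exact one_add_norm_le k m
      _ = (1 + ‖m‖) ^ N * ((1 + ‖k - m‖) ^ N * ‖g (k - m)‖) := by rw [mul_pow]; ring
      _ ≤ (1 + ‖m‖) ^ N * D := by gcongr; exact hD _
  have hD0 : 0 ≤ D := le_trans (by positivity) (hD 0)
  have h1 : ‖stft g f (m, w)‖ ≤ C * D * (1 + ‖m‖) ^ N := by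
    refine (hC _).trans ?_
    calc _ ≤ C * ((1 + ‖m‖) ^ N * D) := by gcongr
      _ = _ := by ring
  have h2 := ENNReal.ofReal_le_ofReal h1
  rwa [ENNReal.ofReal_mul (by positivity), ENNReal.ofReal_pow (by positivity),
    ENNReal.ofReal_add zero_le_one (norm_nonneg _), ofReal_norm, ofReal_norm,
    ENNReal.ofReal_one] at h2

/-! ### The short-time Fourier transform as a Fourier series -/

theorem volume_unitAddTorus_univ (n : ℕ) :
    (volume : Measure (UnitAddTorus (Fin n))) Set.univ = 1 := by
  rw [volume_pi, ← Set.pi_univ Set.univ, Measure.pi_pi]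
  simp

instance isProbabilityMeasure_unitAddTorus (n : ℕ) :
    IsProbabilityMeasure (volume : Measure (UnitAddTorus (Fin n))) :=
  ⟨volume_unitAddTorus_univ n⟩

theorem integral_mFourier {n : ℕ} {k : Fin n → ℤ} (hk : k ≠ 0) :
    ∫ w : UnitAddTorus (Fin n), UnitAddTorus.mFourier k w = 0 := by
  obtain ⟨i, hi⟩ := Function.ne_iff.mp hk
  -- Translation by half a period in a coordinate where `k i ≠ 0` changes the sign of the character.
  refine integral_eq_zero_of_add_right_eq_neg
    (g := (Pi.single i ((1 / 2 / (k i : ℝ) : ℝ) : UnitAddCircle) : UnitAddTorus (Fin n)))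
    fun w => ?_
  change ∏ j, fourier (k j) _ = - ∏ j, fourier (k j) (w j)
  rw [← Finset.mul_prod_erase _ _ (Finset.mem_univ i),
    ← Finset.mul_prod_erase _ _ (Finset.mem_univ i), ← neg_mul]
  congr 1
  · rw [Pi.add_apply, Pi.single_eq_same]
    exact fourier_add_half_inv_index hi one_pos (w i)
  · refine Finset.prod_congr rfl fun j hj => ?_
    rw [Pi.add_apply, Pi.single_eq_of_ne (Finset.ne_of_mem_erase hj), add_zero]

theorem hasSum_stft {n : ℕ} (g : SchwartzZ n) (f : TemperedZ n) (m : Fin n → ℤ)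
    (w : UnitAddTorus (Fin n)) :
    HasSum (fun k => UnitAddTorus.mFourier (-k) w * (conj (g (k - m)) * f (delta k)))
      (stft g f (m, w)) := by
  have := hasSum_coeff f (conjugate (modulate w (translate m g)))
  simp only [stft_arg_apply, mul_assoc] at this
  exact this

theorem summable_norm_coeff {n : ℕ} (g : SchwartzZ n) (f : TemperedZ n) (m : Fin n → ℤ) :
    Summable fun k => ‖conj (g (k - m)) * f (delta k)‖ := by
  have := (hasSum_stft g f m 0).summable.norm
  simpa only [norm_mul, norm_mFourier_apply, one_mul] using this

theorem enorm_stft_le {n : ℕ} (g : SchwartzZ n) (f : TemperedZ n) (m : Fin n → ℤ)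
    (w : UnitAddTorus (Fin n)) :
    ‖stft g f (m, w)‖ₑ ≤ ∑' k, ‖f (delta k)‖ₑ * ‖g (k - m)‖ₑ := by
  rw [← (hasSum_stft g f m w).tsum_eq]
  refine enorm_tsum_le_tsum_enorm.trans (ENNReal.tsum_le_tsum fun k => ?_)
  rw [← ofReal_norm, norm_mul, norm_mFourier_apply, one_mul, ofReal_norm, enorm_mul,
    RCLike.enorm_conj, mul_comm]

theorem continuous_stft {n : ℕ} (g : SchwartzZ n) (f : TemperedZ n) (m : Fin n → ℤ) :
    Continuous fun w => stft g f (m, w) := by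
  simp_rw [← (hasSum_stft g f m _).tsum_eq]
  refine continuous_tsum (fun k => by fun_prop) (summable_norm_coeff g f m) fun k w => ?_
  rw [norm_mul, norm_mFourier_apply, one_mul]

theorem measurable_stft {n : ℕ} (g : SchwartzZ n) (f : TemperedZ n) : Measurable (stft g f) :=
  measurable_from_prod_countable_right fun m => (continuous_stft g f m).measurable

theorem integral_mFourier_mul_stft {n : ℕ} (g : SchwartzZ n) (f : TemperedZ n)
    (m k : Fin n → ℤ) :
    ∫ w, UnitAddTorus.mFourier k w * stft g f (m, w) = conj (g (k - m)) * f (delta k) := by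
  have h1 : ∀ w, HasSum
      (fun j => UnitAddTorus.mFourier (k - j) w * (conj (g (j - m)) * f (delta j)))
      (UnitAddTorus.mFourier k w * stft g f (m, w)) := fun w => by
    simpa only [sub_eq_add_neg, UnitAddTorus.mFourier_add, mul_assoc] using
      (hasSum_stft g f m w).mul_left (UnitAddTorus.mFourier k w)
  have hint : ∀ j : Fin n → ℤ, Integrable fun w : UnitAddTorus (Fin n) =>
      UnitAddTorus.mFourier (k - j) w * (conj (g (j - m)) * f (delta j)) := fun j =>
    Continuous.integrable_of_hasCompactSupport (by fun_prop) (HasCompactSupport.of_compactSpace _)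
  have h2 := hasSum_integral_of_summable_integral_norm hint (by
    simpa [norm_mul, norm_mFourier_apply] using summable_norm_coeff g f m)
  simp_rw [(h1 _).tsum_eq] at h2
  rw [← h2.tsum_eq, tsum_eq_single k]
  · simp [UnitAddTorus.mFourier_zero]
  · intro j hj
    rw [integral_mul_const, integral_mFourier (sub_ne_zero.mpr hj.symm), zero_mul]

/-- The left side is the modulus of a Fourier coefficient of the slice. -/
theorem enorm_coeff_mul_le {n : ℕ} (g : SchwartzZ n) (f : TemperedZ n) (m k : Fin n → ℤ) :
    ‖f (delta k)‖ₑ * ‖g (k - m)‖ₑ ≤ ∫⁻ w, ‖stft g f (m, w)‖ₑ := by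
  have := enorm_integral_le_lintegral_enorm (μ := volume)
    fun w => UnitAddTorus.mFourier k w * stft g f (m, w)
  rw [integral_mFourier_mul_stft, enorm_mul, RCLike.enorm_conj, mul_comm] at this
  refine this.trans (lintegral_mono fun w => ?_)
  rw [← ofReal_norm, norm_mul, norm_mFourier_apply, one_mul, ofReal_norm]

theorem lintegral_phaseMeasure {n : ℕ} {F : (Fin n → ℤ) × UnitAddTorus (Fin n) → ℝ≥0∞}
    (hF : Measurable F) :
    ∫⁻ z, F z ∂phaseMeasure n = ∑' m, ∫⁻ w, F (m, w) := by
  rw [phaseMeasure, lintegral_prod _ hF.aemeasurable, lintegral_count]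

/-! ### Truncation of tempered distributions -/

/-- The restriction of a tempered distribution to a finite set. -/
noncomputable def truncate {n : ℕ} (f : TemperedZ n) (F : Finset (Fin n → ℤ)) : TemperedZ n :=
  ∑ k ∈ F, f (delta k) • pointMass k

theorem truncate_delta {n : ℕ} (f : TemperedZ n) (F : Finset (Fin n → ℤ)) (i : Fin n → ℤ) :
    truncate f F (delta i) = if i ∈ F then f (delta i) else 0 := by
  simp [truncate, pointMass_apply, delta_apply]

theorem enorm_sub_truncate_delta {n : ℕ} (f : TemperedZ n) (F : Finset (Fin n → ℤ))
    (i : Fin n → ℤ) :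
    ‖(f - truncate f F) (delta i)‖ₑ = if i ∈ F then 0 else ‖f (delta i)‖ₑ := by
  rw [_root_.sub_apply, truncate_delta]
  split_ifs <;> simp

theorem stft_truncate {n : ℕ} (g : SchwartzZ n) (f : TemperedZ n) (F : Finset (Fin n → ℤ)) :
    stft g (truncate f F) = ∑ k ∈ F, f (delta k) • stft g (pointMass k) := by
  ext z
  simp [stft, truncate]

/-- The transform has modulus `|g (k - m)|`, and `g` lies in every `ℓ^q`. -/
theorem pointMass_mem_modSpace {n : ℕ} (g : SchwartzZ n) (k : Fin n → ℤ) {p : ℝ≥0∞} (hp : 0 < p)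
    (hp' : p ≠ ∞) : pointMass k ∈ modSpace g p := by
  refine ⟨(measurable_stft g _).aestronglyMeasurable, ?_⟩
  rw [eLpNorm_lt_top_iff_lintegral_rpow_enorm_lt_top hp.ne' hp']
  have hq := ENNReal.toReal_pos hp.ne' hp'
  have h1 : ∀ m w, ‖stft g (pointMass k) (m, w)‖ₑ = ‖g (k - m)‖ₑ := fun m w => by
    rw [← ofReal_norm, stft, pointMass_apply, norm_stft_arg_apply, ofReal_norm]
  rw [lintegral_phaseMeasure ((measurable_stft g _).enorm.pow_const _)]
  simp only [h1, lintegral_const, measure_univ, mul_one]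
  have h2 := (Equiv.subLeft k).tsum_eq fun j => ‖g j‖ₑ ^ p.toReal
  simp only [Equiv.subLeft_apply] at h2
  rw [h2]
  simpa using (g.tsum_ne_top 0 hq).lt_top

theorem truncate_mem_modSpace {n : ℕ} (g : SchwartzZ n) (f : TemperedZ n)
    (F : Finset (Fin n → ℤ)) {p : ℝ≥0∞} (hp : 0 < p) (hp' : p ≠ ∞) :
    truncate f F ∈ modSpace g p := by
  change MemLp _ _ _
  rw [stft_truncate]
  exact memLp_finsetSum' _ fun k _ => (pointMass_mem_modSpace g k hp hp').const_smul _

/-! ### Pointwise bounds for the short-time Fourier transform -/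

theorem lintegral_enorm_le_rpow_mul {X : Type*} [MeasurableSpace X] {μ : Measure X} {F : X → ℂ}
    {B : ℝ≥0∞} (hB : ∀ x, ‖F x‖ₑ ≤ B) (hB' : B ≠ ∞) {q : ℝ} (hq : 0 < q) (hq1 : q ≤ 1) :
    ∫⁻ x, ‖F x‖ₑ ∂μ ≤ B ^ (1 - q) * ∫⁻ x, ‖F x‖ₑ ^ q ∂μ := by
  have h1 : 0 ≤ 1 - q := sub_nonneg.mpr hq1
  rw [← lintegral_const_mul' _ _ (ENNReal.rpow_ne_top_of_nonneg h1 hB')]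
  refine lintegral_mono fun x => ?_
  calc ‖F x‖ₑ = ‖F x‖ₑ ^ (1 - q) * ‖F x‖ₑ ^ q := by
        rw [← ENNReal.rpow_add_of_nonneg _ _ h1 hq.le]; simp
    _ ≤ B ^ (1 - q) * ‖F x‖ₑ ^ q := by gcongr; exact hB x

theorem lintegral_slice_le {n : ℕ} {F : (Fin n → ℤ) × UnitAddTorus (Fin n) → ℝ≥0∞}
    (hF : Measurable F) (m : Fin n → ℤ) :
    ∫⁻ w, F (m, w) ≤ ∫⁻ z, F z ∂phaseMeasure n := by
  rw [lintegral_phaseMeasure hF]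
  exact ENNReal.le_tsum m

/-- The coefficients of `f` are controlled by the integrals of `V_g f` over the fibres. -/
theorem enorm_coeff_le {n : ℕ} {g : SchwartzZ n} {k₀ : Fin n → ℤ} (f : TemperedZ n)
    (k : Fin n → ℤ) :
    ‖f (delta k)‖ₑ * ‖g k₀‖ₑ ≤ ∫⁻ w, ‖stft g f (k - k₀, w)‖ₑ := by
  simpa using enorm_coeff_mul_le g f (k - k₀) k

theorem enorm_stft_le_of_coeff_le {n : ℕ} (g : SchwartzZ n) (f : TemperedZ n) {β : ℝ≥0∞}
    (hβ : ∀ k, ‖f (delta k)‖ₑ ≤ β) (m : Fin n → ℤ) (w : UnitAddTorus (Fin n)) :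
    ‖stft g f (m, w)‖ₑ ≤ β * ∑' k, ‖g k‖ₑ := by
  refine (enorm_stft_le g f m w).trans ?_
  have h2 := (Equiv.subRight m).tsum_eq fun k => ‖g k‖ₑ
  simp only [Equiv.subRight_apply] at h2
  rw [← h2, ← ENNReal.tsum_mul_left]
  exact ENNReal.tsum_le_tsum fun k => mul_le_mul_left (hβ k) _

theorem enorm_stft_le_of_lintegral_le {n : ℕ} {g : SchwartzZ n} {k₀ : Fin n → ℤ}
    (hk₀ : g k₀ ≠ 0) (f : TemperedZ n) {β : ℝ≥0∞}
    (hβ : ∀ m, ∫⁻ w, ‖stft g f (m, w)‖ₑ ≤ β) (z : (Fin n → ℤ) × UnitAddTorus (Fin n)) :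
    ‖stft g f z‖ₑ ≤ (∑' k, ‖g k‖ₑ) / ‖g k₀‖ₑ * β := by
  have h0 : ‖g k₀‖ₑ ≠ 0 := by simpa using hk₀
  refine (enorm_stft_le_of_coeff_le g f (β := β / ‖g k₀‖ₑ) (fun k => ?_) z.1 z.2).trans_eq ?_
  · rw [ENNReal.le_div_iff_mul_le (Or.inl h0) (Or.inl enorm_ne_top)]
    exact (enorm_coeff_le f k).trans (hβ _)
  · rw [mul_comm, ← mul_div_assoc, ENNReal.mul_div_right_comm]

/-- A self-improving estimate: the weighted supremum `S` satisfies `S ≤ const * P * S^(1-q)`, and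
the growth hypothesis makes `S` finite, so `S^(1-q)` cancels. The resulting constant depends on `N`
but not on `C`. -/
theorem enorm_stft_rpow_le {n : ℕ} {g : SchwartzZ n} {k₀ : Fin n → ℤ} (hk₀ : g k₀ ≠ 0)
    {f : TemperedZ n} {q : ℝ} (hq : 0 < q) (hq1 : q ≤ 1) {N : ℕ} {C : ℝ≥0∞} (hC : C ≠ ∞)
    (hf : ∀ m w, ‖stft g f (m, w)‖ₑ ≤ C * (1 + ‖m‖ₑ) ^ N)
    (z : (Fin n → ℤ) × UnitAddTorus (Fin n)) :
    ‖stft g f z‖ₑ ^ q ≤ (∫⁻ z, ‖stft g f z‖ₑ ^ q ∂phaseMeasure n) *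
      (‖g k₀‖ₑ⁻¹ * ((1 + ‖k₀‖ₑ) ^ N * ∑' k, (1 + ‖k‖ₑ) ^ N * ‖g k‖ₑ)) := by
  obtain ⟨m₀, w₀⟩ := z
  set P := ∫⁻ z, ‖stft g f z‖ₑ ^ q ∂phaseMeasure n with hP
  set M := ∑' k, (1 + ‖k‖ₑ) ^ N * ‖g k‖ₑ with hM
  have h0 : ‖g k₀‖ₑ ≠ 0 := by simpa using hk₀
  have h1q : 0 ≤ 1 - q := sub_nonneg.mpr hq1
  -- The weight is centred at `m₀`, so it equals `1` there and `S` bounds the value sought.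
  let W : (Fin n → ℤ) → ℝ≥0∞ := fun m => (1 + ‖m - m₀‖ₑ) ^ N
  have hW1 : ∀ m, 1 ≤ W m := fun m => one_le_pow₀ (by simp)
  have hW0 : ∀ m, W m ≠ 0 := fun m => (zero_lt_one.trans_le (hW1 m)).ne'
  have hWt : ∀ m, W m ≠ ∞ := fun m => by simp only [W]; finiteness
  set S := ⨆ m, ⨆ w, ‖stft g f (m, w)‖ₑ / W m with hS
  have hSt : S ≠ ∞ := by
    refine ne_top_of_le_ne_top (b := C * (1 + ‖m₀‖ₑ) ^ N) (by finiteness)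
      (iSup_le fun m => iSup_le fun w => ?_)
    refine ENNReal.div_le_of_le_mul ((hf m w).trans ?_)
    rw [mul_assoc, ← mul_pow]
    gcongr
    exact one_add_enorm_le m m₀
  have hVS : ∀ m w, ‖stft g f (m, w)‖ₑ ≤ S * W m := fun m w => by
    rw [← ENNReal.div_le_iff_le_mul (Or.inl (hW0 m)) (Or.inl (hWt m))]
    exact le_iSup₂ (f := fun m w => ‖stft g f (m, w)‖ₑ / W m) m w
  have hint : ∀ m, ∫⁻ w, ‖stft g f (m, w)‖ₑ ≤ S ^ (1 - q) * P * W m := fun m => by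
    refine (lintegral_enorm_le_rpow_mul (hVS m) (ENNReal.mul_ne_top hSt (hWt m)) hq hq1).trans ?_
    rw [ENNReal.mul_rpow_of_nonneg _ _ h1q, mul_right_comm]
    gcongr
    · exact lintegral_slice_le ((measurable_stft g f).enorm.pow_const q) m
    -- As `W ≥ 1`, the power `W^(1-q)` is at most `W`.
    · exact (ENNReal.rpow_le_rpow_of_exponent_le (hW1 m) (sub_le_self 1 hq.le)).trans_eq
        (ENNReal.rpow_one _)
  have hcoeff : ∀ k, ‖f (delta k)‖ₑ ≤ ‖g k₀‖ₑ⁻¹ * (S ^ (1 - q) * P * W (k - k₀)) := fun k => by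
    rw [mul_comm, ← div_eq_mul_inv, ENNReal.le_div_iff_mul_le (Or.inl h0) (Or.inl enorm_ne_top)]
    exact (enorm_coeff_le f k).trans (hint _)
  have hWW : ∀ k j, W (k - k₀) ≤ W j * ((1 + ‖k₀‖ₑ) ^ N * (1 + ‖k - j‖ₑ) ^ N) := fun k j => by
    simp only [W]
    rw [← mul_pow, ← mul_pow]
    refine pow_le_pow_left' ((one_add_enorm_le _ (j - m₀)).trans ?_) N
    refine mul_le_mul_right (le_trans (one_add_enorm_le _ (-k₀)) ?_) _
    rw [enorm_neg]
    refine le_of_eq ?_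
    congr 3
    abel
  have hSS : S ≤ P * (‖g k₀‖ₑ⁻¹ * ((1 + ‖k₀‖ₑ) ^ N * M)) * S ^ (1 - q) := by
    refine iSup_le fun j => iSup_le fun w => ?_
    refine ENNReal.div_le_of_le_mul ((enorm_stft_le g f j w).trans ?_)
    have h2 := (Equiv.subRight j).tsum_eq fun k => (1 + ‖k‖ₑ) ^ N * ‖g k‖ₑ
    simp only [Equiv.subRight_apply] at h2
    rw [hM, ← h2]
    simp_rw [← ENNReal.tsum_mul_left, ← ENNReal.tsum_mul_right]
    refine ENNReal.tsum_le_tsum fun k => ?_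
    calc ‖f (delta k)‖ₑ * ‖g (k - j)‖ₑ
        ≤ ‖g k₀‖ₑ⁻¹ * (S ^ (1 - q) * P * (W j * ((1 + ‖k₀‖ₑ) ^ N * (1 + ‖k - j‖ₑ) ^ N)))
            * ‖g (k - j)‖ₑ := by
          gcongr
          refine (hcoeff k).trans ?_
          gcongr
          exact hWW k j
      _ = _ := by ring
  have hz : ‖stft g f (m₀, w₀)‖ₑ ≤ S := by simpa [W] using hVS m₀ w₀
  refine (ENNReal.rpow_le_rpow hz hq.le).trans ?_
  rcases eq_or_ne S 0 with hS0 | hS0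
  · rw [hS0, ENNReal.zero_rpow_of_pos hq]; exact zero_le
  · have hc0 : S ^ (1 - q) ≠ 0 := (ENNReal.rpow_pos (pos_iff_ne_zero.mpr hS0) hSt).ne'
    have hct : S ^ (1 - q) ≠ ∞ := ENNReal.rpow_ne_top_of_nonneg h1q hSt
    rw [← ENNReal.mul_le_mul_iff_left hc0 hct]
    refine le_trans (le_of_eq ?_) hSS
    rw [← ENNReal.rpow_add_of_nonneg _ _ hq.le h1q]
    simp

theorem modNorm_eq {n : ℕ} (g : SchwartzZ n) {p : ℝ≥0∞} (hp : 0 < p) (hp' : p ≠ ∞)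
    (f : TemperedZ n) :
    modNorm g p f = (∫⁻ z, ‖stft g f z‖ₑ ^ p.toReal ∂phaseMeasure n) ^ (1 / p.toReal) :=
  eLpNorm_eq_lintegral_rpow_enorm_toReal hp.ne' hp'

theorem SchwartzZ.exists_ne_zero {n : ℕ} {g : SchwartzZ n} (hg : g ≠ 0) : ∃ k, g k ≠ 0 := by
  by_contra! h
  exact hg (Subtype.ext (funext h))

theorem exists_enorm_stft_le_modNorm {n : ℕ} {g : SchwartzZ n} (hg : g ≠ 0) {p : ℝ≥0∞}
    (hp : 0 < p) (hp' : p ≠ ∞) :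
    ∃ K : ℝ≥0∞, K ≠ ∞ ∧ ∀ f ∈ modSpace g p, ∀ z, ‖stft g f z‖ₑ ≤ K * modNorm g p f := by
  obtain ⟨k₀, hk₀⟩ := SchwartzZ.exists_ne_zero hg
  have h0 : ‖g k₀‖ₑ ≠ 0 := by simpa using hk₀
  have hq := ENNReal.toReal_pos hp.ne' hp'
  rcases le_total p.toReal 1 with hq1 | hq1
  · have hcon : ∀ N : ℕ, ‖g k₀‖ₑ⁻¹ * ((1 + ‖k₀‖ₑ) ^ N * ∑' k, (1 + ‖k‖ₑ) ^ N * ‖g k‖ₑ) ≠ ∞ :=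
      fun N => by
        have := g.tsum_ne_top N one_pos
        simp only [ENNReal.rpow_one] at this
        finiteness
    refine ⟨_, ENNReal.rpow_ne_top_of_nonneg (inv_nonneg.mpr hq.le) (hcon 0), fun f hf z => ?_⟩
    obtain ⟨N, C, hC, hV⟩ := exists_enorm_stft_le g f
    have hP : (∫⁻ z, ‖stft g f z‖ₑ ^ p.toReal ∂phaseMeasure n) ≠ ∞ :=
      ((eLpNorm_lt_top_iff_lintegral_rpow_enorm_lt_top hp.ne' hp').mp hf.2).ne
    have hbd := fun z => enorm_stft_rpow_le hk₀ hq hq1 hC hV z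
    simp_rw [← ENNReal.le_rpow_inv_iff hq] at hbd
    -- The order `N` depends on `f`, so the first pass only shows that `V_g f` is bounded. A second
    -- pass with `N = 0` yields a constant independent of `f`.
    have hbd2 := enorm_stft_rpow_le hk₀ hq hq1 (N := 0)
      (ENNReal.rpow_ne_top_of_nonneg (inv_nonneg.mpr hq.le) (ENNReal.mul_ne_top hP (hcon N)))
      (fun m w => by simpa using hbd (m, w)) z
    rw [modNorm_eq g hp hp', one_div]
    rwa [← ENNReal.le_rpow_inv_iff hq, mul_comm,
      ENNReal.mul_rpow_of_nonneg _ _ (inv_nonneg.mpr hq.le)] at hbd2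
  · refine ⟨_, ENNReal.div_ne_top g.tsum_enorm_ne_top h0, fun f hf =>
      enorm_stft_le_of_lintegral_le hk₀ f fun m => ?_⟩
    rw [← eLpNorm_one_eq_lintegral_enorm, modNorm_eq g hp hp']
    have hp1 : 1 ≤ p := by
      rwa [← ENNReal.toReal_one, ENNReal.toReal_le_toReal ENNReal.one_ne_top hp'] at hq1
    refine (eLpNorm_le_eLpNorm_of_exponent_le hp1
      (continuous_stft g f m).aestronglyMeasurable).trans ?_
    rw [eLpNorm_eq_lintegral_rpow_enorm_toReal hp.ne' hp']
    gcongr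
    exact lintegral_slice_le ((measurable_stft g f).enorm.pow_const _) m

/-! ### A weak form of Jensen's inequality -/

/-- `Ψ (c x) ≤ c Ψ x` for `c ≤ 1`. -/
def StarShaped (Ψ : ℝ≥0∞ → ℝ≥0∞) : Prop := ∀ c x, c ≤ 1 → Ψ (c * x) ≤ c * Ψ x

theorem StarShaped.map_zero {Ψ : ℝ≥0∞ → ℝ≥0∞} (h : StarShaped Ψ) : Ψ 0 = 0 := by
  simpa using h 0 0 zero_le_one

theorem StarShaped.mul_le_of_le {Ψ : ℝ≥0∞ → ℝ≥0∞} (h : StarShaped Ψ) {t y : ℝ≥0∞} (hy : y ≠ ∞)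
    (hty : t ≤ y) : y * Ψ t ≤ t * Ψ y := by
  rcases eq_or_ne y 0 with rfl | hy0
  · simp
  have h1 := h (t / y) y (ENNReal.div_le_of_le_mul (by simpa using hty))
  rw [ENNReal.div_mul_cancel hy0 hy] at h1
  calc y * Ψ t ≤ y * (t / y * Ψ y) := by gcongr
    _ = t * Ψ y := by rw [← mul_assoc, ENNReal.mul_div_cancel hy0 hy]

/-- A linear lower bound for `Ψ` replacing the supporting line: for `y ≤ t` the last term alone
suffices. -/
theorem StarShaped.mul_le {Ψ : ℝ≥0∞ → ℝ≥0∞} (h : StarShaped Ψ) {y : ℝ≥0∞} (hy : y ≠ ∞)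
    (t : ℝ≥0∞) : y * Ψ t ≤ t * Ψ y + t * Ψ t := by
  rcases le_total t y with hty | hty
  · exact (h.mul_le_of_le hy hty).trans le_self_add
  · exact (mul_le_mul_left hty _).trans le_add_self

theorem le_of_two_mul_le {t A B : ℝ≥0∞} (ht0 : t ≠ 0) (ht : t ≠ ∞) (hA : A ≠ ∞)
    (h : 2 * t * A ≤ t * B + t * A) : A ≤ B := by
  rw [mul_assoc, two_mul, ENNReal.add_le_add_iff_right (ENNReal.mul_ne_top ht hA),
    ENNReal.mul_le_mul_iff_right ht0 ht] at h
  exact h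

/-- Integrate `StarShaped.mul_le` with `y = F x`. The factor `2` in the hypothesis pays for the
extra `t * Ψ t`, which then cancels. -/
theorem StarShaped.le_lintegral {Ψ : ℝ≥0∞ → ℝ≥0∞} (h : StarShaped Ψ) {X : Type*}
    [MeasurableSpace X] {μ : Measure X} [IsProbabilityMeasure μ] {F : X → ℝ≥0∞}
    (hF : ∀ x, F x ≠ ∞) {t : ℝ≥0∞} (ht : t ≠ ∞) (hΨ : Ψ t ≠ ∞) (htF : 2 * t ≤ ∫⁻ x, F x ∂μ) :
    Ψ t ≤ ∫⁻ x, Ψ (F x) ∂μ := by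
  rcases eq_or_ne t 0 with rfl | ht0
  · rw [h.map_zero]; exact zero_le
  refine le_of_two_mul_le ht0 ht hΨ ?_
  calc 2 * t * Ψ t ≤ (∫⁻ x, F x ∂μ) * Ψ t := by gcongr
    _ = ∫⁻ x, F x * Ψ t ∂μ := (lintegral_mul_const' _ _ hΨ).symm
    _ ≤ ∫⁻ x, (t * Ψ (F x) + t * Ψ t) ∂μ := lintegral_mono fun x => h.mul_le (hF x) t
    _ = _ := by
      rw [lintegral_add_right _ measurable_const, lintegral_const_mul' _ _ ht]
      simp

theorem StarShaped.le_tsum {Ψ : ℝ≥0∞ → ℝ≥0∞} (h : StarShaped Ψ) {ι : Type*} {v x : ι → ℝ≥0∞}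
    (hv : ∑' i, v i ≤ 1) (hx : ∀ i, x i ≠ ∞) {t : ℝ≥0∞} (ht : t ≠ ∞) (hΨ : Ψ t ≠ ∞)
    (htx : 2 * t ≤ ∑' i, v i * x i) :
    Ψ t ≤ ∑' i, v i * Ψ (x i) := by
  rcases eq_or_ne t 0 with rfl | ht0
  · rw [h.map_zero]; exact zero_le
  refine le_of_two_mul_le ht0 ht hΨ ?_
  calc 2 * t * Ψ t ≤ (∑' i, v i * x i) * Ψ t := by gcongr
    _ = ∑' i, v i * (x i * Ψ t) := by simp_rw [← ENNReal.tsum_mul_right, mul_assoc]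
    _ ≤ ∑' i, v i * (t * Ψ (x i) + t * Ψ t) := by
        refine ENNReal.tsum_le_tsum fun i => ?_
        gcongr
        exact h.mul_le (hx i) t
    _ = t * ∑' i, v i * Ψ (x i) + (∑' i, v i) * (t * Ψ t) := by
        rw [← ENNReal.tsum_mul_left, ← ENNReal.tsum_mul_right, ← ENNReal.tsum_add]
        refine tsum_congr fun i => by ring
    _ ≤ t * ∑' i, v i * Ψ (x i) + 1 * (t * Ψ t) := by gcongr
    _ = _ := by rw [one_mul]

theorem StarShaped.monotone {Ψ : ℝ≥0∞ → ℝ≥0∞} (h : StarShaped Ψ) (htop : Ψ ∞ = ∞) :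
    Monotone Ψ := by
  intro x y hxy
  rcases eq_or_ne y ∞ with rfl | hy
  · simp [htop]
  rcases eq_or_ne y 0 with rfl | hy0
  · rw [le_zero_iff.mp hxy]
  rw [← ENNReal.mul_le_mul_iff_right hy0 hy]
  exact (h.mul_le_of_le hy hxy).trans (mul_le_mul_left hxy _)

theorem starShaped_sq : StarShaped fun x => x ^ 2 := fun c x hc => by
  change (c * x) ^ 2 ≤ c * x ^ 2
  rw [mul_pow]
  gcongr
  exact (sq c).trans_le (mul_le_of_le_one_left zero_le hc)

theorem IsYoung.starShaped {Φ : ℝ≥0∞ → ℝ≥0∞} (hΦ : IsYoung Φ) : StarShaped Φ := by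
  intro c x hc
  lift c to ℝ≥0 using ne_top_of_le_ne_top ENNReal.one_ne_top hc
  have hc' : c ≤ 1 := by exact_mod_cast hc
  have := hΦ.convex.2 (Set.mem_univ x) (Set.mem_univ 0) (zero_le (a := c))
    (zero_le (a := 1 - c)) (add_tsub_cancel_of_le hc')
  simpa [hΦ.map_zero, ENNReal.smul_def] using this

theorem IsYoung.monotone {Φ : ℝ≥0∞ → ℝ≥0∞} (hΦ : IsYoung Φ) : Monotone Φ :=
  hΦ.starShaped.monotone hΦ.map_top

/-! ### Density of truncations -/

theorem modNorm_two {n : ℕ} (g : SchwartzZ n) (f : TemperedZ n) :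
    modNorm g 2 f = (∫⁻ z, ‖stft g f z‖ₑ ^ 2 ∂phaseMeasure n) ^ (1 / 2 : ℝ) := by
  rw [modNorm_eq g two_pos ENNReal.ofNat_ne_top]
  simp

theorem lintegral_sq_ne_top {n : ℕ} {g : SchwartzZ n} {f : TemperedZ n} (hf : f ∈ modSpace g 2) :
    ∫⁻ z, ‖stft g f z‖ₑ ^ 2 ∂phaseMeasure n ≠ ∞ := by
  have := (eLpNorm_lt_top_iff_lintegral_rpow_enorm_lt_top two_ne_zero
    ENNReal.ofNat_ne_top).mp hf.2
  simpa using this.ne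

/-- Weak Jensen for the square on each slice puts the coefficients in `ℓ²`. -/
theorem finite_le_enorm_coeff {n : ℕ} {g : SchwartzZ n} (hg : g ≠ 0) {f : TemperedZ n}
    (hf : f ∈ modSpace g 2) {δ : ℝ≥0∞} (hδ : δ ≠ 0) : {k | δ ≤ ‖f (delta k)‖ₑ}.Finite := by
  obtain ⟨k₀, hk₀⟩ := SchwartzZ.exists_ne_zero hg
  have h0 : ‖g k₀‖ₑ ≠ 0 := by simpa using hk₀
  have hle : ∀ k, (‖f (delta k)‖ₑ * ‖g k₀‖ₑ / 2) ^ 2 ≤ ∫⁻ w, ‖stft g f (k - k₀, w)‖ₑ ^ 2 :=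
    fun k => starShaped_sq.le_lintegral (fun _ => enorm_ne_top) (by finiteness) (by finiteness)
      (by
        rw [ENNReal.mul_div_cancel two_ne_zero ENNReal.ofNat_ne_top]
        exact enorm_coeff_le f k)
  have hsum : ∑' k, (‖f (delta k)‖ₑ * ‖g k₀‖ₑ / 2) ^ 2 ≠ ∞ := by
    refine ne_top_of_le_ne_top (lintegral_sq_ne_top hf) ?_
    refine (ENNReal.tsum_le_tsum hle).trans_eq ?_
    rw [lintegral_phaseMeasure ((measurable_stft g f).enorm.pow_const 2)]
    exact (Equiv.subRight k₀).tsum_eq fun m => ∫⁻ w, ‖stft g f (m, w)‖ₑ ^ 2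
  have hε : (δ * ‖g k₀‖ₑ / 2) ^ 2 ≠ 0 := by simp [hδ, h0]
  refine (ENNReal.finite_const_le_of_tsum_ne_top hsum hε).subset fun k hk => ?_
  have hk' : δ ≤ ‖f (delta k)‖ₑ := hk
  change (δ * ‖g k₀‖ₑ / 2) ^ 2 ≤ (‖f (delta k)‖ₑ * ‖g k₀‖ₑ / 2) ^ 2
  gcongr

/-- The growth condition is needed only below `x₀`, since `Ψ` may be infinite further out. It
converts the single scale `b₀` at which the integral is finite into an arbitrary scale `b`. -/
theorem exists_lintegral_sub_truncate_le_one {n : ℕ} {g : SchwartzZ n} (hg : g ≠ 0)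
    {Ψ : ℝ≥0∞ → ℝ≥0∞} (hs : StarShaped Ψ) (hm : Monotone Ψ) {x₀ : ℝ≥0∞} (hx₀ : x₀ ≠ 0)
    (hx₀' : x₀ ≠ ∞) (hΨ : Ψ x₀ ≠ ∞)
    (hΔ : ∀ t x, 1 ≤ t → t * x ≤ x₀ → Ψ (t * x) ≤ t ^ 2 * Ψ x)
    {f : TemperedZ n} (hf : f ∈ modSpace g 2) {b₀ : ℝ≥0} (hb₀ : 0 < b₀)
    (hfΨ : ∫⁻ z, Ψ (‖stft g f z‖ₑ / b₀) ∂phaseMeasure n ≠ ∞) {b : ℝ≥0} (hb : 0 < b) :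
    ∃ F : Finset (Fin n → ℤ),
      ∫⁻ z, Ψ (‖stft g (f - truncate f F) z‖ₑ / b) ∂phaseMeasure n ≤ 1 := by
  obtain ⟨k₀, hk₀⟩ := SchwartzZ.exists_ne_zero hg
  have h0 : ‖g k₀‖ₑ ≠ 0 := by simpa using hk₀
  have hmeas : ∀ (h : TemperedZ n) (b : ℝ≥0), Measurable fun z => Ψ (‖stft g h z‖ₑ / b) :=
    fun h b => hm.measurable.comp ((measurable_stft g h).enorm.div_const _)
  have hb0 : (b : ℝ≥0∞) ≠ 0 := by exact_mod_cast hb.ne'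
  have hb₀0 : (b₀ : ℝ≥0∞) ≠ 0 := by exact_mod_cast hb₀.ne'
  set G := ∑' k, ‖g k‖ₑ with hG
  have hGt : G ≠ ∞ := g.tsum_enorm_ne_top
  have hG0 : G ≠ 0 := fun h => h0 (ENNReal.tsum_eq_zero.mp h k₀)
  set J : (Fin n → ℤ) → ℝ≥0∞ := fun m => ∫⁻ w, Ψ (‖stft g f (m, w)‖ₑ / b₀) with hJ
  rw [lintegral_phaseMeasure (hmeas f b₀)] at hfΨ
  -- With this `s`, `2 s |f (delta k)|` is at most a slice integral of `|V_g f| / b₀`. Below, `r` is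
  -- the scale needed for `b`, and `T ≥ 1` satisfies `r ≤ T s`.
  set s : ℝ≥0∞ := ‖g k₀‖ₑ / b₀ / 2 with hs_def
  have hs0 : s ≠ 0 := by simp [s, h0]
  have hst : s ≠ ∞ := by simp only [s]; finiteness
  set r : ℝ≥0∞ := 2 * G / b with hr
  have hrt : r ≠ ∞ := by simp only [r]; finiteness
  set T : ℝ≥0∞ := max 1 (r / s) with hT
  have hT1 : 1 ≤ T := le_max_left _ _
  have hTt : T ≠ ∞ := by simp only [T]; exact (max_lt (by simp) (by finiteness)).ne
  have hT0 : T ≠ 0 := (zero_lt_one.trans_le hT1).ne'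
  have hrT : r ≤ T * s := by
    calc r = r / s * s := (ENNReal.div_mul_cancel hs0 hst).symm
      _ ≤ T * s := by gcongr; exact le_max_right _ _
  have hTs0 : T * s ≠ 0 := mul_ne_zero hT0 hs0
  have hTst : T * s ≠ ∞ := ENNReal.mul_ne_top hTt hst
  have hfin := finite_le_enorm_coeff hg hf (δ := x₀ / (T * s))
    (ENNReal.div_ne_zero.mpr ⟨hx₀, hTst⟩)
  have hJsum : ∑' k, J (k - k₀) ≠ ∞ := by
    have h2 := (Equiv.subRight k₀).tsum_eq J
    simp only [Equiv.subRight_apply] at h2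
    rwa [h2]
  -- `F` contains every index with `T s |f (delta k)| ≥ x₀`, and leaves a tail of `J` below `T⁻²`,
  -- which offsets the factor `T²` from the growth condition.
  obtain ⟨F, hF, hFJ⟩ := ((eventually_ge_atTop hfin.toFinset).and
    ((ENNReal.tendsto_tsum_compl_atTop_zero hJsum).eventually_lt_const
      (ENNReal.inv_pos.mpr (ENNReal.pow_ne_top (n := 2) hTt)))).exists
  refine ⟨F, ?_⟩
  set α : (Fin n → ℤ) → ℝ≥0∞ := fun k => ‖(f - truncate f F) (delta k)‖ₑ with hα
  have hαF : ∀ k ∈ F, α k = 0 := fun k hk =>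
    (enorm_sub_truncate_delta f F k).trans (if_pos hk)
  have hαF' : ∀ k ∉ F, α k = ‖f (delta k)‖ₑ := fun k hk =>
    (enorm_sub_truncate_delta f F k).trans (if_neg hk)
  have hsmall : ∀ k, T * (s * α k) ≤ x₀ := fun k => by
    by_cases hk : k ∈ F
    · simp [hαF k hk]
    · have hk' : ‖f (delta k)‖ₑ ≤ x₀ / (T * s) := by
        by_contra hlt
        exact hk (hF (by rw [Set.Finite.mem_toFinset]; exact (not_le.mp hlt).le))
      rw [hαF' k hk, ← mul_assoc, mul_comm]
      exact (ENNReal.le_div_iff_mul_le (Or.inl hTs0) (Or.inl hTst)).mp hk'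
  set J' : (Fin n → ℤ) → ℝ≥0∞ := fun k => if k ∈ F then 0 else J (k - k₀) with hJ'
  have hcoef : ∀ k, Ψ (s * α k) ≤ J' k := fun k => by
    by_cases hk : k ∈ F
    · simp [hαF k hk, hs.map_zero]
    · simp only [J', hk, if_false]
      have hle : s * α k ≤ x₀ := (le_mul_of_one_le_left zero_le hT1).trans (hsmall k)
      refine hs.le_lintegral (fun w => by finiteness) (ne_top_of_le_ne_top hx₀' hle)
        (ne_top_of_le_ne_top hΨ (hm hle)) ?_
      simp_rw [div_eq_mul_inv]
      rw [lintegral_mul_const' _ _ (by finiteness), ← div_eq_mul_inv]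
      calc 2 * (s * α k) = 2 * s * α k := (mul_assoc _ _ _).symm
        _ = ‖f (delta k)‖ₑ * ‖g k₀‖ₑ / b₀ := by
          rw [hs_def, ENNReal.mul_div_cancel two_ne_zero ENNReal.ofNat_ne_top, hαF' k hk,
            mul_comm, mul_div_assoc]
        _ ≤ _ := by gcongr; exact enorm_coeff_le f k
  have hcoef' : ∀ k, Ψ (r * α k) ≤ T ^ 2 * J' k := fun k => by
    refine (hm (?_ : r * α k ≤ T * (s * α k))).trans
      ((hΔ T _ hT1 (hsmall k)).trans (by gcongr; exact hcoef k))
    rw [← mul_assoc]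
    gcongr
  have hv : ∀ m, ∑' k, ‖g (k - m)‖ₑ / G = 1 := fun m => by
    have h2 := (Equiv.subRight m).tsum_eq fun k => ‖g k‖ₑ
    simp only [Equiv.subRight_apply] at h2
    simp_rw [div_eq_mul_inv]
    rw [ENNReal.tsum_mul_right, h2, ENNReal.mul_inv_cancel hG0 hGt]
  -- The weights sum to `1` over `k`, for Jensen at fixed `m`, and also over `m`, for the final
  -- interchange of sums.
  have hv' : ∀ k, ∑' m, ‖g (k - m)‖ₑ / G = 1 := fun k => by
    have h2 := (Equiv.subLeft k).tsum_eq fun k => ‖g k‖ₑ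
    simp only [Equiv.subLeft_apply] at h2
    simp_rw [div_eq_mul_inv]
    rw [ENNReal.tsum_mul_right, h2, ENNReal.mul_inv_cancel hG0 hGt]
  have hpt : ∀ m w, Ψ (‖stft g (f - truncate f F) (m, w)‖ₑ / b)
      ≤ ∑' k, ‖g (k - m)‖ₑ / G * (T ^ 2 * J' k) := fun m w => by
    have htx : 2 * (‖stft g (f - truncate f F) (m, w)‖ₑ / b)
        ≤ ∑' k, ‖g (k - m)‖ₑ / G * (r * α k) := by
      calc 2 * (‖stft g (f - truncate f F) (m, w)‖ₑ / b)
          ≤ 2 * ((∑' k, α k * ‖g (k - m)‖ₑ) / b) := by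
            gcongr; exact enorm_stft_le g _ m w
        _ = ∑' k, 2 * (α k * ‖g (k - m)‖ₑ * (b : ℝ≥0∞)⁻¹) := by
            rw [ENNReal.tsum_mul_left, ENNReal.tsum_mul_right, div_eq_mul_inv]
        _ = _ := by
            refine tsum_congr fun k => ?_
            calc 2 * (α k * ‖g (k - m)‖ₑ * (b : ℝ≥0∞)⁻¹)
                = G * G⁻¹ * (2 * (α k * ‖g (k - m)‖ₑ * (b : ℝ≥0∞)⁻¹)) := by
                  rw [ENNReal.mul_inv_cancel hG0 hGt, one_mul]
              _ = _ := by rw [hr, div_eq_mul_inv, div_eq_mul_inv]; ring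
    have hxk : ∀ k, r * α k ≤ x₀ := fun k => by
      refine le_trans ?_ (hsmall k)
      rw [← mul_assoc]
      gcongr
    have htx₀ : ‖stft g (f - truncate f F) (m, w)‖ₑ / b ≤ x₀ := by
      calc _ ≤ 2 * (‖stft g (f - truncate f F) (m, w)‖ₑ / b) :=
            le_mul_of_one_le_left zero_le one_le_two
        _ ≤ ∑' k, ‖g (k - m)‖ₑ / G * x₀ :=
            htx.trans (ENNReal.tsum_le_tsum fun k => by gcongr; exact hxk k)
        _ = x₀ := by rw [ENNReal.tsum_mul_right, hv, one_mul]
    refine (hs.le_tsum (hv m).le (fun k => ne_top_of_le_ne_top hx₀' (hxk k))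
      (ne_top_of_le_ne_top hx₀' htx₀) (ne_top_of_le_ne_top hΨ (hm htx₀)) htx).trans ?_
    exact ENNReal.tsum_le_tsum fun k => by gcongr; exact hcoef' k
  rw [lintegral_phaseMeasure (hmeas _ b)]
  calc ∑' m, ∫⁻ w, Ψ (‖stft g (f - truncate f F) (m, w)‖ₑ / b)
      ≤ ∑' m, ∫⁻ _w : UnitAddTorus (Fin n), ∑' k, ‖g (k - m)‖ₑ / G * (T ^ 2 * J' k) :=
        ENNReal.tsum_le_tsum fun m => lintegral_mono fun w => hpt m w
    _ = ∑' m, ∑' k, ‖g (k - m)‖ₑ / G * (T ^ 2 * J' k) := by simp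
    _ = ∑' k, T ^ 2 * J' k := by
        rw [ENNReal.tsum_comm]
        refine tsum_congr fun k => ?_
        rw [ENNReal.tsum_mul_right, hv', one_mul]
    _ = T ^ 2 * ∑' k : {k // k ∉ F}, J (k - k₀) := by
        rw [ENNReal.tsum_mul_left]
        congr 1
        have h3 := tsum_subtype {k | k ∉ F} fun k => J (k - k₀)
        refine Eq.trans (tsum_congr fun k => ?_) h3.symm
        by_cases hk : k ∈ F <;> simp [J', Set.indicator, hk]
    _ ≤ T ^ 2 * (T ^ 2)⁻¹ := by gcongr
    _ ≤ 1 := ENNReal.mul_inv_le_one _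

/-! ### The entropy function near the origin -/

/-- The function `Φ` is `-x² log x` on `[0, e^{-3/2}]`. -/
def IsEntropyNearZero (Φ : ℝ≥0∞ → ℝ≥0∞) : Prop :=
  ∀ x : ℝ, 0 ≤ x → x ≤ Real.exp (-(3 / 2)) →
    Φ (ENNReal.ofReal x) = ENNReal.ofReal (-x ^ 2 * Real.log x)

/-- The right endpoint `e^{-3/2}` of the interval on which `Φ` is given. -/
noncomputable def entropyRadius : ℝ≥0∞ := ENNReal.ofReal (Real.exp (-(3 / 2)))

theorem entropyRadius_ne_zero : entropyRadius ≠ 0 := by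
  simp [entropyRadius, Real.exp_pos]

theorem entropyRadius_ne_top : entropyRadius ≠ ∞ := ENNReal.ofReal_ne_top

theorem exists_real_of_le_entropyRadius {x : ℝ≥0∞} (hx : x ≤ entropyRadius) :
    ∃ a : ℝ, 0 ≤ a ∧ a ≤ Real.exp (-(3 / 2)) ∧ x = ENNReal.ofReal a := by
  have hxt := ne_top_of_le_ne_top entropyRadius_ne_top hx
  exact ⟨x.toReal, ENNReal.toReal_nonneg,
    ENNReal.toReal_le_of_le_ofReal (Real.exp_pos _).le hx, (ENNReal.ofReal_toReal hxt).symm⟩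

theorem log_le_of_le_exp {a : ℝ} (ha : 0 < a) (ha' : a ≤ Real.exp (-(3 / 2))) :
    Real.log a ≤ -(3 / 2) := by
  simpa using Real.log_le_log ha ha'

namespace IsEntropyNearZero

variable {Φ : ℝ≥0∞ → ℝ≥0∞}

theorem radius_ne_top (h : IsEntropyNearZero Φ) : Φ entropyRadius ≠ ∞ := by
  rw [entropyRadius, h _ (Real.exp_pos _).le le_rfl]
  exact ENNReal.ofReal_ne_top

theorem sq_le (h : IsEntropyNearZero Φ) {x : ℝ≥0∞} (hx : x ≤ entropyRadius) :
    x ^ 2 ≤ Φ x := by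
  obtain ⟨a, ha, ha', rfl⟩ := exists_real_of_le_entropyRadius hx
  rw [h a ha ha', ← ENNReal.ofReal_pow ha]
  refine ENNReal.ofReal_le_ofReal ?_
  rcases ha.eq_or_lt with rfl | hpos
  · simp
  · nlinarith [log_le_of_le_exp hpos ha', sq_nonneg a]

theorem radius_ne_zero (h : IsEntropyNearZero Φ) : Φ entropyRadius ≠ 0 := fun h0 => by
  have := h.sq_le le_rfl
  rw [h0, nonpos_iff_eq_zero] at this
  exact pow_ne_zero 2 entropyRadius_ne_zero this

theorem mul_le_sq_mul (h : IsEntropyNearZero Φ) (t x : ℝ≥0∞) (ht : 1 ≤ t)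
    (htx : t * x ≤ entropyRadius) : Φ (t * x) ≤ t ^ 2 * Φ x := by
  have hx : x ≤ entropyRadius := (le_mul_of_one_le_left zero_le ht).trans htx
  rcases eq_or_ne x 0 with rfl | hx0
  · have h0 := h 0 le_rfl (Real.exp_pos _).le
    simp only [ENNReal.ofReal_zero] at h0
    simp [h0]
  have htt : t ≠ ∞ := fun htop => by
    rw [htop, ENNReal.top_mul hx0, top_le_iff] at htx
    exact entropyRadius_ne_top htx
  obtain ⟨a, ha, ha', rfl⟩ := exists_real_of_le_entropyRadius hx
  have hapos : 0 < a := by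
    refine ha.lt_of_ne fun h' => hx0 ?_
    simp [← h']
  obtain ⟨c, hc1, rfl⟩ : ∃ c : ℝ, 1 ≤ c ∧ t = ENNReal.ofReal c :=
    ⟨t.toReal, by rwa [← ENNReal.toReal_one, ENNReal.toReal_le_toReal ENNReal.one_ne_top htt],
      (ENNReal.ofReal_toReal htt).symm⟩
  have hc0 : 0 ≤ c := zero_le_one.trans hc1
  rw [← ENNReal.ofReal_mul hc0] at htx ⊢
  have hca : c * a ≤ Real.exp (-(3 / 2)) :=
    (ENNReal.ofReal_le_ofReal_iff (Real.exp_pos _).le).mp htx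
  rw [h _ (by positivity) hca, h a ha ha', ← ENNReal.ofReal_pow hc0,
    ← ENNReal.ofReal_mul (by positivity)]
  refine ENNReal.ofReal_le_ofReal ?_
  rw [Real.log_mul (by positivity) hapos.ne']
  have hlog := Real.log_nonneg hc1
  -- Since `log (c a) = log c + log a` with `log c ≥ 0`, the extra term can be dropped.
  have : 0 ≤ (c * a) ^ 2 * Real.log c := by positivity
  linarith [mul_pow c a 2, show -(c * a) ^ 2 * (Real.log c + Real.log a)
    = -((c * a) ^ 2 * Real.log c) + c ^ 2 * (-a ^ 2 * Real.log a) by ring]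

theorem le_rpow (h : IsEntropyNearZero Φ) {q : ℝ} (hq : 0 < q) (hq2 : q < 2) {x : ℝ≥0∞}
    (hx : x ≤ entropyRadius) : Φ x ≤ ENNReal.ofReal (1 / (2 - q)) * x ^ q := by
  obtain ⟨a, ha, ha', rfl⟩ := exists_real_of_le_entropyRadius hx
  have h2q : 0 < 2 - q := sub_pos.mpr hq2
  rw [h a ha ha', ENNReal.ofReal_rpow_of_nonneg ha hq.le, ← ENNReal.ofReal_mul (by positivity)]
  refine ENNReal.ofReal_le_ofReal ?_
  rcases ha.eq_or_lt with rfl | hpos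
  · simp [Real.zero_rpow hq.ne']
  -- This is `log (1 / a) ≤ a^(-(2 - q)) / (2 - q)`.
  have h1 := Real.log_le_rpow_div (x := a⁻¹) (by positivity) h2q
  rw [Real.log_inv, Real.inv_rpow ha] at h1
  have h3 : a ^ (2 : ℕ) = a ^ q * a ^ (2 - q) := by
    rw [← Real.rpow_add hpos, ← Real.rpow_natCast]; norm_num
  have h4 : 0 < a ^ (2 - q) := by positivity
  calc -a ^ 2 * Real.log a = a ^ 2 * -Real.log a := by ring
    _ ≤ a ^ 2 * ((a ^ (2 - q))⁻¹ / (2 - q)) := by gcongr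
    _ = 1 / (2 - q) * a ^ q := by
      rw [h3]; field_simp

end IsEntropyNearZero

/-! ### The inclusions -/

theorem orliczModNorm_le_of_lintegral_le {n : ℕ} {g : SchwartzZ n} {Φ : ℝ≥0∞ → ℝ≥0∞}
    {f : TemperedZ n} {b : ℝ≥0} (hb : 0 < b)
    (h : ∫⁻ z, Φ (‖stft g f z‖ₑ / b) ∂phaseMeasure n ≤ 1) : orliczModNorm g Φ f ≤ b :=
  iInf_le_of_le b (iInf₂_le hb h)

theorem exists_orliczModNorm_le_mul {n : ℕ} {g : SchwartzZ n} (hg : g ≠ 0) {Φ : ℝ≥0∞ → ℝ≥0∞}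
    (hlog : IsEntropyNearZero Φ) {p : ℝ≥0∞} (hp : 0 < p) (hp2 : p < 2) :
    ∃ C : ℝ≥0, ∀ f ∈ modSpace g p, orliczModNorm g Φ f ≤ C * modNorm g p f := by
  have hp' : p ≠ ∞ := (hp2.trans_le le_top).ne
  have hq := ENNReal.toReal_pos hp.ne' hp'
  have hq2 : p.toReal < 2 := by
    rwa [← ENNReal.toReal_lt_toReal hp' ENNReal.ofNat_ne_top] at hp2
  obtain ⟨K, hK, hKf⟩ := exists_enorm_stft_le_modNorm hg hp hp'
  set D := ENNReal.ofReal (1 / (2 - p.toReal)) with hD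
  have hr0 := entropyRadius_ne_zero
  have hrt := entropyRadius_ne_top
  -- The first summand brings `|V_g f| / b` into the range where `Φ` is known; the second makes the
  -- integral of `Φ` at most `1`.
  set L := K / entropyRadius + D ^ (1 / p.toReal) with hL
  have hLt : L ≠ ∞ := ENNReal.add_ne_top.mpr ⟨ENNReal.div_ne_top hK hr0,
    ENNReal.rpow_ne_top_of_nonneg (by positivity) ENNReal.ofReal_ne_top⟩
  refine ⟨L.toNNReal, fun f hf => ?_⟩
  rw [ENNReal.coe_toNNReal hLt]
  -- The scale `b` is taken strictly above `L * modNorm g p f`, so it is positive even when the norm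
  -- vanishes.
  refine le_of_forall_gt fun c hc => ?_
  obtain ⟨b, hLb, hbc⟩ := ENNReal.lt_iff_exists_nnreal_btwn.mp hc
  refine lt_of_le_of_lt ?_ hbc
  have hb : 0 < b := by exact_mod_cast zero_le.trans_lt hLb
  have hb0 : (b : ℝ≥0∞) ≠ 0 := by exact_mod_cast hb.ne'
  have hbq0 : (b : ℝ≥0∞) ^ p.toReal ≠ 0 :=
    (ENNReal.rpow_pos (pos_iff_ne_zero.mpr hb0) (by simp)).ne'
  have hbqt : (b : ℝ≥0∞) ^ p.toReal ≠ ∞ := ENNReal.rpow_ne_top_of_nonneg hq.le (by simp)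
  have hsmall : ∀ z, ‖stft g f z‖ₑ / b ≤ entropyRadius := fun z => by
    refine ENNReal.div_le_of_le_mul ((hKf f hf z).trans ?_)
    calc K * modNorm g p f = entropyRadius * (K / entropyRadius * modNorm g p f) := by
          rw [← mul_assoc, ENNReal.mul_div_cancel hr0 hrt]
      _ ≤ entropyRadius * b := by
          gcongr
          refine le_trans ?_ hLb.le
          gcongr
          exact le_self_add
  refine orliczModNorm_le_of_lintegral_le hb ?_
  calc ∫⁻ z, Φ (‖stft g f z‖ₑ / b) ∂phaseMeasure n
      ≤ ∫⁻ z, D / b ^ p.toReal * ‖stft g f z‖ₑ ^ p.toReal ∂phaseMeasure n := by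
        refine lintegral_mono fun z => (hlog.le_rpow hq hq2 (hsmall z)).trans_eq ?_
        rw [ENNReal.div_rpow_of_nonneg _ _ hq.le, ← mul_div_assoc, ENNReal.mul_div_right_comm]
    _ = D / b ^ p.toReal * ∫⁻ z, ‖stft g f z‖ₑ ^ p.toReal ∂phaseMeasure n :=
        lintegral_const_mul' _ _ (ENNReal.div_ne_top ENNReal.ofReal_ne_top hbq0)
    _ ≤ 1 := by
        rw [← ENNReal.mul_div_right_comm]
        refine ENNReal.div_le_of_le_mul ?_
        rw [one_mul, ← ENNReal.rpow_inv_le_iff hq,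
          ENNReal.mul_rpow_of_nonneg _ _ (inv_nonneg.mpr hq.le), ← one_div,
          ← modNorm_eq g hp hp']
        refine le_trans ?_ hLb.le
        gcongr
        exact le_add_self

theorem modSpace_subset_orliczModSpace {n : ℕ} {g : SchwartzZ n} (hg : g ≠ 0)
    {Φ : ℝ≥0∞ → ℝ≥0∞} (hlog : IsEntropyNearZero Φ) {p : ℝ≥0∞} (hp : 0 < p) (hp2 : p < 2) :
    modSpace g p ⊆ orliczModSpace g Φ := fun f hf => by
  obtain ⟨C, hC⟩ := exists_orliczModNorm_le_mul hg hlog hp hp2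
  exact ⟨hf.1, (hC f hf).trans_lt (ENNReal.mul_lt_top ENNReal.coe_lt_top hf.2)⟩

theorem exists_modNorm_two_le_of_lintegral_le {n : ℕ} {g : SchwartzZ n} (hg : g ≠ 0)
    {Φ : ℝ≥0∞ → ℝ≥0∞} (hΦ : IsYoung Φ) (hlog : IsEntropyNearZero Φ) :
    ∃ L : ℝ≥0∞, L ≠ 0 ∧ L ≠ ∞ ∧ ∀ (f : TemperedZ n) (b : ℝ≥0), 0 < b →
      ∫⁻ z, Φ (‖stft g f z‖ₑ / b) ∂phaseMeasure n ≤ 1 → modNorm g 2 f ≤ L * b := by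
  obtain ⟨k₀, hk₀⟩ := SchwartzZ.exists_ne_zero hg
  have h0 : ‖g k₀‖ₑ ≠ 0 := by simpa using hk₀
  set r := entropyRadius with hr
  have hr0 : r ≠ 0 := entropyRadius_ne_zero
  have hrt : r ≠ ∞ := entropyRadius_ne_top
  have hΦ0 : Φ r ≠ 0 := hlog.radius_ne_zero
  have hΦt : Φ r ≠ ∞ := hlog.radius_ne_top
  -- `A` bounds `|V_g f| / b`: the last factor bounds its slice integrals, by integrating
  -- `StarShaped.mul_le` at `t = r`.
  set A := (∑' k, ‖g k‖ₑ) / ‖g k₀‖ₑ * (r * (1 + Φ r) / Φ r) with hA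
  have hAt : A ≠ ∞ := ENNReal.mul_ne_top (ENNReal.div_ne_top g.tsum_enorm_ne_top h0)
    (by finiteness)
  -- The `1` serves values `y ≤ r`, where `y² ≤ Φ y`. For `r ≤ y ≤ A`, star-shapedness gives `y ≤ (r
  -- / Φ r) Φ y`, hence `y² ≤ A (r / Φ r) Φ y`.
  set E := 1 + A * (r / Φ r) with hE
  have hEt : E ≠ ∞ := by finiteness
  refine ⟨E ^ (1 / 2 : ℝ), ?_, by finiteness, fun f b hb hfb => ?_⟩
  · exact (ENNReal.rpow_pos (zero_lt_one.trans_le le_self_add) hEt).ne'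
  have hb0 : (b : ℝ≥0∞) ≠ 0 := by exact_mod_cast hb.ne'
  have hbt : (b : ℝ≥0∞) ≠ ∞ := ENNReal.coe_ne_top
  have hmeas : Measurable fun z => Φ (‖stft g f z‖ₑ / b) :=
    hΦ.monotone.measurable.comp ((measurable_stft g f).enorm.div_const _)
  have hint : ∀ m, ∫⁻ w, ‖stft g f (m, w)‖ₑ ≤ r * (1 + Φ r) / Φ r * b := fun m => by
    rw [← ENNReal.div_le_iff_le_mul (Or.inl hb0) (Or.inl hbt),
      ENNReal.le_div_iff_mul_le (Or.inl hΦ0) (Or.inl hΦt), div_eq_mul_inv,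
      ← lintegral_mul_const' _ _ (by finiteness), ← lintegral_mul_const' _ _ hΦt]
    calc ∫⁻ w, ‖stft g f (m, w)‖ₑ * (b : ℝ≥0∞)⁻¹ * Φ r
        ≤ ∫⁻ w, (r * Φ (‖stft g f (m, w)‖ₑ / b) + r * Φ r) := by
          refine lintegral_mono fun w => ?_
          rw [← div_eq_mul_inv]
          exact hΦ.starShaped.mul_le (by finiteness) r
      _ = r * (∫⁻ w, Φ (‖stft g f (m, w)‖ₑ / b)) + r * Φ r := by
          rw [lintegral_add_right _ measurable_const, lintegral_const_mul' _ _ hrt]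
          simp
      _ ≤ r * 1 + r * Φ r := by
          gcongr
          exact (lintegral_slice_le hmeas m).trans hfb
      _ = r * (1 + Φ r) := (mul_add _ _ _).symm
  have hVA : ∀ z, ‖stft g f z‖ₑ / b ≤ A := fun z => by
    refine ENNReal.div_le_of_le_mul ((enorm_stft_le_of_lintegral_le hk₀ f hint z).trans_eq ?_)
    rw [hA, mul_assoc]
  have hsq : ∀ z, (‖stft g f z‖ₑ / b) ^ 2 ≤ E * Φ (‖stft g f z‖ₑ / b) := fun z => by
    rcases le_total (‖stft g f z‖ₑ / b) r with hle | hle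
    · refine (hlog.sq_le hle).trans (le_mul_of_one_le_left zero_le le_self_add)
    · have h1 := hΦ.starShaped.mul_le_of_le (y := ‖stft g f z‖ₑ / b) (by finiteness) hle
      rw [← ENNReal.le_div_iff_mul_le (Or.inl hΦ0) (Or.inl hΦt),
        ENNReal.mul_div_right_comm] at h1
      calc (‖stft g f z‖ₑ / b) ^ 2 = ‖stft g f z‖ₑ / b * (‖stft g f z‖ₑ / b) := sq _
        _ ≤ A * (r / Φ r * Φ (‖stft g f z‖ₑ / b)) := by gcongr; exact hVA z
        _ = A * (r / Φ r) * Φ (‖stft g f z‖ₑ / b) := (mul_assoc _ _ _).symm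
        _ ≤ E * Φ (‖stft g f z‖ₑ / b) := by gcongr; exact le_add_self
  rw [modNorm_two]
  have hfin : ∫⁻ z, ‖stft g f z‖ₑ ^ 2 ∂phaseMeasure n ≤ E * (b : ℝ≥0∞) ^ (2 : ℝ) := by
    rw [ENNReal.rpow_ofNat]
    calc ∫⁻ z, ‖stft g f z‖ₑ ^ 2 ∂phaseMeasure n
        = ∫⁻ z, (b : ℝ≥0∞) ^ 2 * (‖stft g f z‖ₑ / b) ^ 2 ∂phaseMeasure n := by
          refine lintegral_congr fun z => ?_
          rw [← mul_pow, ENNReal.mul_div_cancel hb0 hbt]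
      _ ≤ ∫⁻ z, (b : ℝ≥0∞) ^ 2 * (E * Φ (‖stft g f z‖ₑ / b)) ∂phaseMeasure n := by
          gcongr with z
          exact hsq z
      _ = (b : ℝ≥0∞) ^ 2 * (E * ∫⁻ z, Φ (‖stft g f z‖ₑ / b) ∂phaseMeasure n) := by
          rw [lintegral_const_mul' _ _ (by finiteness), lintegral_const_mul' _ _ hEt]
      _ ≤ (b : ℝ≥0∞) ^ 2 * (E * 1) := by gcongr
      _ = E * (b : ℝ≥0∞) ^ 2 := by rw [mul_one, mul_comm]
  calc _ ≤ (E * (b : ℝ≥0∞) ^ (2 : ℝ)) ^ (1 / 2 : ℝ) := by gcongr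
    _ = _ := by
      rw [ENNReal.mul_rpow_of_nonneg _ _ (by norm_num), ← ENNReal.rpow_mul]
      norm_num

theorem exists_modNorm_two_le_mul {n : ℕ} {g : SchwartzZ n} (hg : g ≠ 0)
    {Φ : ℝ≥0∞ → ℝ≥0∞} (hΦ : IsYoung Φ) (hlog : IsEntropyNearZero Φ) :
    ∃ C : ℝ≥0, ∀ f : TemperedZ n, modNorm g 2 f ≤ C * orliczModNorm g Φ f := by
  obtain ⟨L, hL0, hLt, hL⟩ := exists_modNorm_two_le_of_lintegral_le hg hΦ hlog
  refine ⟨L.toNNReal, fun f => ?_⟩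
  rw [ENNReal.coe_toNNReal hLt, mul_comm, ← ENNReal.div_le_iff_le_mul (Or.inl hL0) (Or.inl hLt)]
  refine le_iInf fun b => le_iInf₂ fun hb hfb => ?_
  rw [ENNReal.div_le_iff_le_mul (Or.inl hL0) (Or.inl hLt), mul_comm]
  exact hL f b hb hfb

theorem orliczModSpace_subset_modSpace_two {n : ℕ} {g : SchwartzZ n} (hg : g ≠ 0)
    {Φ : ℝ≥0∞ → ℝ≥0∞} (hΦ : IsYoung Φ) (hlog : IsEntropyNearZero Φ) :
    orliczModSpace g Φ ⊆ modSpace g 2 := fun f hf => by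
  obtain ⟨C, hC⟩ := exists_modNorm_two_le_mul hg hΦ hlog
  exact ⟨hf.1, (hC f).trans_lt (ENNReal.mul_lt_top ENNReal.coe_lt_top hf.2)⟩

/-! ### Density -/

theorem exists_orliczModNorm_sub_truncate_lt {n : ℕ} {g : SchwartzZ n} (hg : g ≠ 0)
    {Φ : ℝ≥0∞ → ℝ≥0∞} (hΦ : IsYoung Φ) (hlog : IsEntropyNearZero Φ) {f : TemperedZ n}
    (hf : f ∈ orliczModSpace g Φ) {ε : ℝ≥0∞} (hε : 0 < ε) :
    ∃ F, orliczModNorm g Φ (f - truncate f F) < ε := by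
  obtain ⟨b, hb, hbε⟩ := ENNReal.lt_iff_exists_nnreal_btwn.mp hε
  have hb' : 0 < b := by exact_mod_cast hb
  obtain ⟨b₀, h2⟩ := iInf_lt_iff.mp hf.2
  obtain ⟨hb₀, h3⟩ := iInf_lt_iff.mp h2
  obtain ⟨hfb, -⟩ := iInf_lt_iff.mp h3
  obtain ⟨F, hF⟩ := exists_lintegral_sub_truncate_le_one hg hΦ.starShaped hΦ.monotone
    entropyRadius_ne_zero entropyRadius_ne_top hlog.radius_ne_top hlog.mul_le_sq_mul
    (orliczModSpace_subset_modSpace_two hg hΦ hlog hf) hb₀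
    (ne_top_of_le_ne_top ENNReal.one_ne_top hfb) hb'
  exact ⟨F, (orliczModNorm_le_of_lintegral_le hb' hF).trans_lt hbε⟩

theorem exists_modNorm_two_sub_truncate_lt {n : ℕ} {g : SchwartzZ n} (hg : g ≠ 0)
    {f : TemperedZ n} (hf : f ∈ modSpace g 2) {ε : ℝ≥0∞} (hε : 0 < ε) :
    ∃ F, modNorm g 2 (f - truncate f F) < ε := by
  obtain ⟨b, hb, hbε⟩ := ENNReal.lt_iff_exists_nnreal_btwn.mp hε
  have hb' : 0 < b := by exact_mod_cast hb
  have hb0 : (b : ℝ≥0∞) ≠ 0 := hb.ne'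
  obtain ⟨F, hF⟩ := exists_lintegral_sub_truncate_le_one hg starShaped_sq
    (starShaped_sq.monotone (by simp)) one_ne_zero ENNReal.one_ne_top (by simp)
    (fun t x _ _ => (mul_pow t x 2).le) hf (b₀ := 1) one_pos
    (by simpa using lintegral_sq_ne_top hf) hb'
  refine ⟨F, lt_of_le_of_lt ?_ hbε⟩
  have h1 : ∫⁻ z, ‖stft g (f - truncate f F) z‖ₑ ^ 2 ∂phaseMeasure n
      ≤ (b : ℝ≥0∞) ^ (2 : ℝ) := by
    rw [ENNReal.rpow_ofNat]
    calc ∫⁻ z, ‖stft g (f - truncate f F) z‖ₑ ^ 2 ∂phaseMeasure n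
        = ∫⁻ z, (b : ℝ≥0∞) ^ 2 * (‖stft g (f - truncate f F) z‖ₑ / b) ^ 2 ∂phaseMeasure n := by
          refine lintegral_congr fun z => ?_
          rw [← mul_pow, ENNReal.mul_div_cancel hb0 ENNReal.coe_ne_top]
      _ ≤ (b : ℝ≥0∞) ^ 2 * 1 := by
          rw [lintegral_const_mul' _ _ (by finiteness)]
          gcongr
      _ = _ := mul_one _
  rw [modNorm_two]
  calc _ ≤ ((b : ℝ≥0∞) ^ (2 : ℝ)) ^ (1 / 2 : ℝ) := by gcongr
    _ = b := by rw [← ENNReal.rpow_mul]; norm_num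

end OrliczModulation

theorem mainTheorem9 (n : ℕ) (g : OrliczModulation.SchwartzZ n) (hg : g ≠ 0)
    (Φ : ℝ≥0∞ → ℝ≥0∞) (hΦ : OrliczModulation.IsYoung Φ)
    (hlog : ∀ x : ℝ, 0 ≤ x → x ≤ Real.exp (-(3 / 2)) →
      Φ (ENNReal.ofReal x) = ENNReal.ofReal (-x ^ 2 * Real.log x))
    (p : ℝ≥0∞) (hp : 0 < p) (hp2 : p < 2) :
    -- `M^p ⊆ M^Φ`, continuously and densely
    (OrliczModulation.modSpace g p ⊆ OrliczModulation.orliczModSpace g Φ ∧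
      (∃ C : ℝ≥0, ∀ f ∈ OrliczModulation.modSpace g p,
        OrliczModulation.orliczModNorm g Φ f ≤ C * OrliczModulation.modNorm g p f) ∧
      (∀ f ∈ OrliczModulation.orliczModSpace g Φ, ∀ ε : ℝ≥0∞, 0 < ε →
        ∃ h ∈ OrliczModulation.modSpace g p, OrliczModulation.orliczModNorm g Φ (f - h) < ε)) ∧
    -- `M^Φ ⊆ M^2`, continuously and densely
    (OrliczModulation.orliczModSpace g Φ ⊆ OrliczModulation.modSpace g 2 ∧
      (∃ C : ℝ≥0, ∀ f ∈ OrliczModulation.orliczModSpace g Φ,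
        OrliczModulation.modNorm g 2 f ≤ C * OrliczModulation.orliczModNorm g Φ f) ∧
      (∀ f ∈ OrliczModulation.modSpace g 2, ∀ ε : ℝ≥0∞, 0 < ε →
        ∃ h ∈ OrliczModulation.orliczModSpace g Φ,
          OrliczModulation.modNorm g 2 (f - h) < ε)) := by
  have hp' : p ≠ ∞ := (hp2.trans_le le_top).ne
  have hsub := OrliczModulation.modSpace_subset_orliczModSpace hg hlog hp hp2
  obtain ⟨C, hC⟩ := OrliczModulation.exists_modNorm_two_le_mul hg hΦ hlog
  refine ⟨⟨hsub, OrliczModulation.exists_orliczModNorm_le_mul hg hlog hp hp2,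
      fun f hf ε hε => ?_⟩,
    OrliczModulation.orliczModSpace_subset_modSpace_two hg hΦ hlog, ⟨C, fun f _ => hC f⟩,
      fun f hf ε hε => ?_⟩
  · obtain ⟨F, hF⟩ := OrliczModulation.exists_orliczModNorm_sub_truncate_lt hg hΦ hlog hf hε
    exact ⟨_, OrliczModulation.truncate_mem_modSpace g f F hp hp', hF⟩
  · obtain ⟨F, hF⟩ := OrliczModulation.exists_modNorm_two_sub_truncate_lt hg hf hε
    exact ⟨_, hsub (OrliczModulation.truncate_mem_modSpace g f F hp hp'), hF⟩
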